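/- Let $n\ge 1$, let $S\subset S^{n-1}$ be a spherical cap, that is, a set of the form $\{x\in S^{n-1}:\langle u,x\rangle>c\}$ or $\{x\in S^{n-1}:\langle u,x\rangle\ge c\}$ with $u\in S^{n-1}$ and $c<1$ (the full sphere is allowed), and let $C=\{ra: r>0,\ a\in S\}$ be the cone over $S$. Let $m_S$ be the restriction of the rotation-invariant measure on $S^{n-1}$ to $S$, normalized to a probability measure, and let $\lambda$ be the Haar probability measure on the circle $\mathbb{R}/\mathbb{Z}$. For $f:C\to\mathbb{R}$ we say that $f \bmod 1\,(\mathbb{Z}^n)$ is equidistributed if the push-forwards under $f\bmod 1:C\to\mathbb{R}/\mathbb{Z}$ of the uniform probability measures on the finite sets $\{p\in\mathbb{Z}^n\cap C:\|p\|_2<R\}$ converge weakly to $\lambda$ as $R\to\infty$. A probability measure $\mu$ on $\mathbb{R}/\mathbb{Z}$ is called $S$-irrational if $f\bmod 1\,(\mathbb{Z}^n)$ is equidistributed for every smooth $f:C\to\mathbb{R}$ for which there exist an integer $d\ge 1$ and $v\in\mathbb{Z}^n$ such that 1. $\frac{\partial^d f}{\partial v^d}(sx)=\frac{\partial^d f}{\partial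 v^d}(x)$ for all $x\in C$ and $s>0$; 2. $\left(\frac{\partial^d f}{\partial v^d}\bmod 1\right)_*m_S=\mu$; 3. $\frac{\partial^{d+1} f}{\partial v^{d+1}}(x)\to 0$ as $\|x\|_2\to\infty$, $x\in C$. **Theorem.** Let $\mu$ be a probability measure on $\mathbb{R}/\mathbb{Z}$ which is either absolutely continuous with respect to $\lambda$ or the Dirac mass at the class of an irrational number $\alpha$. Then $\mu$ is $S$-irrational. -/

import Mathlib

open MeasureTheory Filter Topology Metric
open scoped ContDiff

noncomputable section

namespace LatticeEquidistribution

/-- Euclidean `n`-space. -/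
abbrev E (n : ℕ) : Type := EuclideanSpace ℝ (Fin n)

/-- The integer vector `v`, seen in Euclidean space. -/
def intVec {n : ℕ} (v : Fin n → ℤ) : E n := WithLp.toLp 2 (fun i => (v i : ℝ))

/-- The integer points of `D` in the Euclidean ball of radius `R` around the origin. -/
def latticePoints {n : ℕ} (D : Set (E n)) (R : ℝ) : Set (E n) :=
  Set.range (intVec (n := n)) ∩ (D ∩ ball 0 R)

/-- The normalized counting measure on the integer points of `D` in the ball of radius `R`
(it is a probability measure as soon as there is such a point). -/
def latticeMeasure {n : ℕ} (D : Set (E n)) (R : ℝ) : Measure (E n) :=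
  ProbabilityTheory.cond Measure.count (latticePoints D R)

/-- Reduction mod `1` of a real-valued function. -/
def modOne {X : Type*} (F : X → ℝ) : X → UnitAddCircle := fun x => (F x : UnitAddCircle)

/-- `F mod 1` is equidistributed on the integer points of the domain `D`: the push-forwards under
`F mod 1` of the normalized counting measures converge weakly to Haar probability measure. -/
def EquidistributedModOne {n : ℕ} (D : Set (E n)) (F : E n → ℝ) : Prop :=
  ∀ φ : C(UnitAddCircle, ℝ),
    Tendsto (fun R : ℝ => ∫ z, φ z ∂((latticeMeasure D R).map (modOne F))) atTop
      (𝓝 (∫ z, φ z ∂(AddCircle.haarAddCircle (T := (1 : ℝ)))))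

/-- Spherical caps: the parts of the unit sphere cut off by an open or a closed half-space, having
non-empty interior. The full sphere is the case `c < -1`. -/
def IsSphericalCap {n : ℕ} (S : Set (sphere (0 : E n) 1)) : Prop :=
  ∃ (u : E n) (c : ℝ), ‖u‖ = 1 ∧ c < 1 ∧
    (S = {x : sphere (0 : E n) 1 | c < inner ℝ u (x : E n)} ∨
      S = {x : sphere (0 : E n) 1 | c ≤ inner ℝ u (x : E n)})

/-- The cone of all positive multiples of points of `S`. -/
def cone {n : ℕ} (S : Set (sphere (0 : E n) 1)) : Set (E n) :=
  {x | ∃ r : ℝ, 0 < r ∧ ∃ a ∈ S, x = r • (a : E n)}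

/-- The restriction to `S` of the rotation-invariant measure of the unit sphere, normalized to be a
probability measure. -/
def capMeasure {n : ℕ} (S : Set (sphere (0 : E n) 1)) : Measure (sphere (0 : E n) 1) :=
  ProbabilityTheory.cond (volume : Measure (E n)).toSphere S

/-- The `d`-th iterated directional derivative along `v` of a function on `C`. It depends on the
values on `C` only; at interior points of `C` it is the usual derivative. -/
def iterDirDeriv {n : ℕ} (C : Set (E n)) (v : E n) (d : ℕ) (f : E n → ℝ) : E n → ℝ :=
  (fun (g : E n → ℝ) (x : E n) => fderivWithin ℝ g C x v)^[d] f

/-- `S`-irrational measures on the circle `ℝ / ℤ`. -/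
def IsIrrationalMeasure {n : ℕ} (S : Set (sphere (0 : E n) 1)) (μ : Measure UnitAddCircle) :
    Prop :=
  ∀ f : E n → ℝ, ContDiffOn ℝ ∞ f (cone S) →
    (∃ (d : ℕ) (v : Fin n → ℤ), 1 ≤ d ∧
      (∀ x ∈ cone S, ∀ s : ℝ, 0 < s →
        iterDirDeriv (cone S) (intVec v) d f (s • x) = iterDirDeriv (cone S) (intVec v) d f x) ∧
      (capMeasure S).map
        (modOne fun x : sphere (0 : E n) 1 => iterDirDeriv (cone S) (intVec v) d f x) = μ ∧
      Tendsto (iterDirDeriv (cone S) (intVec v) (d + 1) f)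
        (comap norm atTop ⊓ 𝓟 (cone S)) (𝓝 0)) →
    EquidistributedModOne (cone S) f

end LatticeEquidistribution

end

/-! Write e(x) = exp(2πix). By Weyl's criterion it suffices that, for each k ≠ 0, the sum of e(k
f(p)) over the integer points p of the cone with ‖p‖ < R is o(R^n). Up to boundary effects this sum
is unchanged when p is replaced by p + jv, so it may be averaged over segments p, p + v, ..., p + (H
- 1)v of fixed length H. Let g be the d-th derivative of f along v. Far from the origin the next
derivative is tiny, so g is nearly constant along a segment, and j ↦ k f(p + jv) is close mod 1 to a
sequence with constant d-th difference θ = k g(p) (`eventually_norm_sum_circleChar_le`).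

Let `weylSup d H θ` be the largest normalized exponential sum of length H over all sequences with
constant d-th difference θ. It is continuous in θ because the lower order coefficients range over a
compact group. Hence its values at k g(p) can be summed over p as a Riemann sum. Since g is
homogeneous of degree 0 and has distribution μ on the cap, the limit is a volume times the
μ-integral of y ↦ `weylSup d H (k • y)` (`setIntegral_cone_eq_mul_integral`). Weyl's theorem,
uniform in the lower order coefficients (`exists_forall_norm_sum_circleChar_le`), makes this
integrand tend to 0 as H → ∞ at every non-torsion y. Dominated convergence concludes, because a
measure of either kind gives the countable torsion subgroup mass zero.
`eventually_norm_sum_interior_cone_le` assembles these estimates. -/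

noncomputable section

namespace LatticeEquidistribution

/-! ### Exponential sums: van der Corput's inequality and Weyl's theorem -/

/-- The character `x ↦ exp (2 π i x)` of the circle. -/
def circleChar (x : UnitAddCircle) : ℂ := (AddCircle.toCircle x : ℂ)

lemma norm_circleChar (x : UnitAddCircle) : ‖circleChar x‖ = 1 := by
  exact Circle.norm_coe _

lemma circleChar_add (x y : UnitAddCircle) :
    circleChar (x + y) = circleChar x * circleChar y := by
  simp [circleChar, AddCircle.toCircle_add]

lemma circleChar_sub (x y : UnitAddCircle) :
    circleChar (x - y) = circleChar x * (starRingEnd ℂ) (circleChar y) := by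
  rw [sub_eq_add_neg, circleChar_add]
  simp only [circleChar, AddCircle.toCircle_neg, Circle.coe_inv_eq_conj]

lemma continuous_circleChar : Continuous circleChar :=
  continuous_subtype_val.comp AddCircle.continuous_toCircle

lemma circleChar_nsmul (k : ℕ) (x : UnitAddCircle) : circleChar (k • x) = circleChar x ^ k := by
  simp [circleChar, AddCircle.toCircle_nsmul]

lemma circleChar_eq_one_iff {x : UnitAddCircle} : circleChar x = 1 ↔ x = 0 := by
  constructor
  · intro h
    apply AddCircle.injective_toCircle one_ne_zero
    rw [AddCircle.toCircle_zero]
    exact Circle.ext (by simpa [circleChar] using h)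
  · rintro rfl
    simp [circleChar]

lemma norm_circleChar_coe_sub_one_le (r : ℝ) :
    ‖circleChar (r : UnitAddCircle) - 1‖ ≤ 2 * Real.pi * |r| := by
  have h : circleChar (r : UnitAddCircle) = Complex.exp (Complex.I * ((2 * Real.pi * r : ℝ) : ℂ)) := by
    rw [circleChar, AddCircle.toCircle_apply_mk, Circle.coe_exp, mul_comm]
    simp
  rw [h]
  refine (Real.norm_exp_I_mul_ofReal_sub_one_le).trans ?_
  rw [Real.norm_eq_abs, abs_mul, abs_of_pos Real.two_pi_pos]

lemma norm_sum_circleChar_le {ι : Type*} (s : Finset ι) (a : ι → UnitAddCircle) :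
    ‖∑ j ∈ s, circleChar (a j)‖ ≤ s.card := by
  refine (norm_sum_le _ _).trans ?_
  simp [norm_circleChar]

lemma norm_sum_range_sub_shift_le (u : ℕ → ℂ) (hu : ∀ j, ‖u j‖ ≤ 1) (N h : ℕ) :
    ‖∑ j ∈ Finset.range N, u j - ∑ j ∈ Finset.range N, u (j + h)‖ ≤ 2 * h := by
  induction h with
  | zero => simp
  | succ h ih =>
    have key : ∑ j ∈ Finset.range N, u (j + h) - ∑ j ∈ Finset.range N, u (j + (h + 1))
        = u h - u (N + h) := by
      have := Finset.sum_range_sub' (fun j => u (j + h)) N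
      rw [← Finset.sum_sub_distrib]
      simpa [add_assoc, add_comm 1 h] using this
    calc ‖∑ j ∈ Finset.range N, u j - ∑ j ∈ Finset.range N, u (j + (h + 1))‖
        = ‖(∑ j ∈ Finset.range N, u j - ∑ j ∈ Finset.range N, u (j + h)) + (u h - u (N + h))‖ := by
          rw [← key]; congr 1; ring
      _ ≤ 2 * h + (1 + 1) := (norm_add_le _ _).trans
          (add_le_add ih ((norm_sub_le _ _).trans (add_le_add (hu _) (hu _))))
      _ = 2 * ((h + 1 : ℕ) : ℝ) := by push_cast; ring

/-- **Van der Corput's inequality**, with the correlations bounded off the diagonal. -/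
lemma norm_sum_le_of_correlation (u : ℕ → ℂ) (hu : ∀ j, ‖u j‖ ≤ 1) (N H : ℕ) {ε : ℝ}
    (hε : 0 ≤ ε)
    (hcor : ∀ h < H, ∀ h' < H, h ≠ h' →
      ‖∑ j ∈ Finset.range N, u (j + h) * (starRingEnd ℂ) (u (j + h'))‖ ≤ ε * N) :
    H * ‖∑ j ∈ Finset.range N, u j‖ ≤ N * √(H + H ^ 2 * ε) + 2 * H ^ 2 := by
  -- Summing H shifted copies of the sum costs at most 2H for each shift. Cauchy-Schwarz then leads
  -- to the sum of ‖V j‖², whose expansion is the double sum of correlations; the diagonal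
  -- contributes H * N.
  set V : ℕ → ℂ := fun j => ∑ h ∈ Finset.range H, u (j + h) with hV
  have h1 : ‖H * ∑ j ∈ Finset.range N, u j - ∑ j ∈ Finset.range N, V j‖ ≤ 2 * H ^ 2 := by
    have : H * ∑ j ∈ Finset.range N, u j - ∑ j ∈ Finset.range N, V j
        = ∑ h ∈ Finset.range H,
          (∑ j ∈ Finset.range N, u j - ∑ j ∈ Finset.range N, u (j + h)) := by
      rw [Finset.sum_sub_distrib, hV, Finset.sum_comm]
      simp
    rw [this]
    calc _ ≤ ∑ h ∈ Finset.range H, 2 * (H : ℝ) := by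
          refine norm_sum_le_of_le _ fun h hh => (norm_sum_range_sub_shift_le u hu N h).trans ?_
          have : (h : ℝ) ≤ H := by exact_mod_cast (Finset.mem_range.mp hh).le
          linarith
      _ = 2 * H ^ 2 := by simp; ring
  have h2 : ∑ j ∈ Finset.range N, ‖V j‖ ^ 2 ≤ N * (H + H ^ 2 * ε) := by
    have e1 : ((∑ j ∈ Finset.range N, ‖V j‖ ^ 2 : ℝ) : ℂ) = ∑ h ∈ Finset.range H,
        ∑ h' ∈ Finset.range H, ∑ j ∈ Finset.range N,
          u (j + h) * (starRingEnd ℂ) (u (j + h')) := by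
      push_cast
      calc _ = ∑ j ∈ Finset.range N, ∑ h ∈ Finset.range H, ∑ h' ∈ Finset.range H,
            u (j + h) * (starRingEnd ℂ) (u (j + h')) := by
            refine Finset.sum_congr rfl fun j _ => ?_
            rw [← Complex.mul_conj', hV, map_sum, Finset.sum_mul_sum]
        _ = _ := by
            rw [Finset.sum_comm]
            refine Finset.sum_congr rfl fun h _ => ?_
            rw [Finset.sum_comm]
    have e2 : ∑ j ∈ Finset.range N, ‖V j‖ ^ 2
        = ‖((∑ j ∈ Finset.range N, ‖V j‖ ^ 2 : ℝ) : ℂ)‖ := by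
      rw [Complex.norm_real, Real.norm_of_nonneg (by positivity)]
    rw [e2, e1]
    calc _ ≤ ∑ h ∈ Finset.range H, ∑ h' ∈ Finset.range H,
          ((if h = h' then (N : ℝ) else 0) + ε * N) := by
          refine norm_sum_le_of_le _ fun h hh => norm_sum_le_of_le _ fun h' hh' => ?_
          split_ifs with heq
          · have : ‖∑ j ∈ Finset.range N, u (j + h) * (starRingEnd ℂ) (u (j + h'))‖ ≤ N := by
              calc _ ≤ ∑ j ∈ Finset.range N, (1 : ℝ) := by
                    refine norm_sum_le_of_le _ fun j _ => ?_
                    rw [norm_mul, RCLike.norm_conj]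
                    exact mul_le_one₀ (hu _) (norm_nonneg _) (hu _)
                _ = N := by simp
            have : 0 ≤ ε * N := by positivity
            linarith
          · rw [zero_add]
            exact hcor h (Finset.mem_range.mp hh) h' (Finset.mem_range.mp hh') heq
      _ = N * (H + H ^ 2 * ε) := by
          simp only [Finset.sum_add_distrib, Finset.sum_ite_eq, Finset.sum_const,
            Finset.card_range, nsmul_eq_mul]
          rw [Finset.sum_congr rfl (g := fun _ => (N : ℝ)) (fun x hx => by simp [Finset.mem_range.mp hx])]
          simp; ring
  have h3 : ‖∑ j ∈ Finset.range N, V j‖ ≤ N * √(H + H ^ 2 * ε) := by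
    have h4 : ‖∑ j ∈ Finset.range N, V j‖ ^ 2 ≤ N * ∑ j ∈ Finset.range N, ‖V j‖ ^ 2 := by
      have := sq_sum_le_card_mul_sum_sq (s := Finset.range N) (f := fun j => ‖V j‖)
      rw [Finset.card_range] at this
      exact (pow_le_pow_left₀ (norm_nonneg _) (norm_sum_le _ _) 2).trans this
    refine abs_le_of_sq_le_sq' ?_ (by positivity) |>.2
    rw [mul_pow, Real.sq_sqrt (by positivity)]
    nlinarith [h4, mul_le_mul_of_nonneg_left h2 (Nat.cast_nonneg (α := ℝ) N)]
  calc H * ‖∑ j ∈ Finset.range N, u j‖ = ‖H * ∑ j ∈ Finset.range N, u j‖ := by simp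
    _ ≤ ‖∑ j ∈ Finset.range N, V j‖ + ‖H * ∑ j ∈ Finset.range N, u j - ∑ j ∈ Finset.range N, V j‖ := by
        rw [add_comm]; exact norm_le_norm_sub_add _ _
    _ ≤ _ := add_le_add h3 h1

/-- Forward differences are additive and commute with shifts. This computes the top difference of
the sequences produced by van der Corput differencing. -/
lemma fwdDiff_iter_shift_sub (d : ℕ) (a : ℕ → UnitAddCircle) (h h' j : ℕ) :
    (fwdDiff 1)^[d] (fun j => a (j + h) - a (j + h')) j =
      (fwdDiff 1)^[d] a (j + h) - (fwdDiff 1)^[d] a (j + h') := by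
  induction d generalizing a j with
  | zero => rfl
  | succ d ih =>
    rw [Function.iterate_succ_apply, Function.iterate_succ_apply, ← ih]
    refine congrFun (congrArg _ (funext fun i => ?_)) j
    simp only [fwdDiff]
    rw [show i + 1 + h = i + h + 1 by ring, show i + 1 + h' = i + h' + 1 by ring]
    abel

lemma eq_add_nsmul_of_fwdDiff_eq {a : ℕ → UnitAddCircle} {θ : UnitAddCircle}
    (ha : ∀ j, fwdDiff 1 a j = θ) (j : ℕ) : a j = a 0 + j • θ := by
  induction j with
  | zero => simp
  | succ j ih =>
    have := ha j
    rw [fwdDiff, sub_eq_iff_eq_add] at this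
    rw [this, ih, succ_nsmul]; abel

/-- **Weyl's theorem**, uniformly in the lower order coefficients: exponential sums along sequences
with a constant non-torsion `d`-th difference are small. -/
theorem exists_forall_norm_sum_circleChar_le (d : ℕ) {θ : UnitAddCircle}
    (hθ : ¬ IsOfFinAddOrder θ) {ε : ℝ} (hε : 0 < ε) :
    ∃ N₀ : ℕ, ∀ N ≥ N₀, ∀ a : ℕ → UnitAddCircle, (∀ j, (fwdDiff 1)^[d + 1] a j = θ) →
      ‖∑ j ∈ Finset.range N, circleChar (a j)‖ ≤ ε * N := by
  induction d generalizing θ ε with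
  | zero =>
    have hz : circleChar θ ≠ 1 := fun h => hθ (by
      rw [circleChar_eq_one_iff.mp h]; exact IsOfFinAddOrder.zero)
    have hz' : 0 < ‖circleChar θ - 1‖ := norm_pos_iff.mpr (sub_ne_zero.mpr hz)
    obtain ⟨N₀, hN₀⟩ := exists_nat_ge (2 / ‖circleChar θ - 1‖ / ε)
    refine ⟨N₀, fun N hN a ha => ?_⟩
    have hsum : ∑ j ∈ Finset.range N, circleChar (a j)
        = circleChar (a 0) * ((circleChar θ ^ N - 1) / (circleChar θ - 1)) := by
      rw [← geom_sum_eq hz, Finset.mul_sum]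
      refine Finset.sum_congr rfl fun j _ => ?_
      rw [eq_add_nsmul_of_fwdDiff_eq (a := a) (θ := θ) ha j, circleChar_add,
        circleChar_nsmul]
    rw [hsum, norm_mul, norm_circleChar, one_mul, norm_div]
    calc _ ≤ 2 / ‖circleChar θ - 1‖ := by
          gcongr
          refine (norm_sub_le _ _).trans ?_
          rw [norm_pow, norm_circleChar]; norm_num
      _ ≤ ε * N := by
          rw [div_le_iff₀ hε] at hN₀
          have : (N₀ : ℝ) ≤ N := by exact_mod_cast hN
          nlinarith
  | succ d ih =>
    -- This choice gives H ≤ H² ε² / 16, so with correlations bounded by ε² / 16 the square root is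
    -- at most H ε / 2. The remaining term 2H² is absorbed by taking N ≥ 4H / ε.
    obtain ⟨H, hH⟩ := exists_nat_ge (16 / ε ^ 2)
    have hHpos : (0 : ℝ) < H := lt_of_lt_of_le (by positivity) hH
    -- Correlating the shifts h and h' lowers the order by one and replaces θ by (h - h')θ, which is
    -- again non-torsion.
    have hcast : ∀ h h' : ℕ, h ≠ h' → ¬ IsOfFinAddOrder ((h : ℤ) • θ - (h' : ℤ) • θ) := by
      intro h h' hne hfin
      rw [← sub_smul] at hfin
      refine hθ ?_
      rw [isOfFinAddOrder_iff_zsmul_eq_zero] at hfin ⊢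
      obtain ⟨m, hm, hm'⟩ := hfin
      refine ⟨m * (h - h'), mul_ne_zero hm (sub_ne_zero.mpr (by exact_mod_cast hne)), ?_⟩
      rw [mul_smul, hm']
    have hε' : 0 < ε ^ 2 / 16 := by positivity
    have : ∀ h h' : ℕ, ∃ N₀ : ℕ, h ≠ h' → ∀ N ≥ N₀, ∀ a : ℕ → UnitAddCircle,
        (∀ j, (fwdDiff 1)^[d + 1] a j = (h : ℤ) • θ - (h' : ℤ) • θ) →
        ‖∑ j ∈ Finset.range N, circleChar (a j)‖ ≤ ε ^ 2 / 16 * N := by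
      intro h h'
      by_cases hne : h = h'
      · exact ⟨0, fun h => (h hne).elim⟩
      · obtain ⟨N₀, hN₀⟩ := ih (hcast h h' hne) hε'
        exact ⟨N₀, fun _ => hN₀⟩
    choose N₀ hN₀ using this
    obtain ⟨N₁, hN₁⟩ := exists_nat_ge (4 * H / ε)
    refine ⟨N₁ + ∑ h ∈ Finset.range H, ∑ h' ∈ Finset.range H, N₀ h h', fun N hN a ha => ?_⟩
    have hcor := norm_sum_le_of_correlation (fun j => circleChar (a j))
      (fun j => (norm_circleChar _).le) N H hε'.le (by
        intro h hh h' hh' hne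
        have := hN₀ h h' hne N ?_ (fun j => a (j + h) - a (j + h')) ?_
        · simpa only [circleChar_sub] using this
        · refine le_trans ?_ ((Nat.le_add_left _ _).trans hN)
          calc N₀ h h' ≤ ∑ h' ∈ Finset.range H, N₀ h h' :=
                Finset.single_le_sum (f := fun h' => N₀ h h') (fun _ _ => Nat.zero_le _)
                  (Finset.mem_range.mpr hh')
            _ ≤ _ := Finset.single_le_sum (f := fun h => ∑ h' ∈ Finset.range H, N₀ h h')
                  (fun _ _ => Nat.zero_le _) (Finset.mem_range.mpr hh)
        · intro j
          rw [fwdDiff_iter_shift_sub]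
          have hb := eq_add_nsmul_of_fwdDiff_eq (a := (fwdDiff 1)^[d + 1] a) (θ := θ) (fun j => by
            rw [← Function.iterate_succ_apply' (fwdDiff 1)]; exact ha j)
          rw [hb (j + h), hb (j + h'), add_nsmul, add_nsmul, natCast_zsmul, natCast_zsmul]
          abel)
    have hs : √(H + H ^ 2 * (ε ^ 2 / 16)) ≤ H * (ε / 2) := by
      refine Real.sqrt_le_iff.mpr ⟨by positivity, ?_⟩
      rw [div_le_iff₀ (by positivity)] at hH
      nlinarith [mul_le_mul_of_nonneg_left hH hHpos.le]
    have hN₁' : 4 * H ≤ ε * N := by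
      rw [div_le_iff₀ hε] at hN₁
      have : (N₁ : ℝ) ≤ N := by exact_mod_cast (Nat.le_add_right _ _).trans hN
      nlinarith
    have hfin : H * ‖∑ j ∈ Finset.range N, circleChar (a j)‖ ≤ H * (ε * N) := by
      have := mul_le_mul_of_nonneg_left hs (Nat.cast_nonneg (α := ℝ) N)
      nlinarith [mul_le_mul_of_nonneg_left hN₁' hHpos.le]
    exact le_of_mul_le_mul_left hfin hHpos

/-! ### The uniform Weyl bound as a continuous function of the top difference -/

/-- The sequences with constant `d`-th difference `θ`, parametrized by their first `d` lower order
differences at `0`. -/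
def polySeq : ℕ → (ℕ → UnitAddCircle) → UnitAddCircle → ℕ → UnitAddCircle
  | 0, _, θ, _ => θ
  | d + 1, b, θ, j => b 0 + ∑ i ∈ Finset.range j, polySeq d (fun i => b (i + 1)) θ i

lemma fwdDiff_iter_polySeq (d : ℕ) (b : ℕ → UnitAddCircle) (θ : UnitAddCircle) (j : ℕ) :
    (fwdDiff 1)^[d] (polySeq d b θ) j = θ := by
  induction d generalizing b with
  | zero => rfl
  | succ d ih =>
    rw [Function.iterate_succ_apply]
    refine Eq.trans (congrFun (congrArg _ (funext fun i => ?_)) j) (ih fun i => b (i + 1))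
    simp [fwdDiff, polySeq, Finset.sum_range_succ]

lemma continuous_polySeq (d j : ℕ) :
    Continuous fun p : UnitAddCircle × (ℕ → UnitAddCircle) => polySeq d p.2 p.1 j := by
  induction d generalizing j with
  | zero => exact continuous_fst
  | succ d ih =>
    refine Continuous.add (by fun_prop) (continuous_finsetSum _ fun i _ => ?_)
    exact (ih i).comp (f := fun p : UnitAddCircle × (ℕ → UnitAddCircle) =>
      (p.1, fun i => p.2 (i + 1))) (by fun_prop)

/-- A real sequence whose `d`-th differences are nearly `θ` is near a sequence whose `d`-th
differences are `θ`. -/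
lemma exists_polySeq_approx (d H : ℕ) (a : ℕ → ℝ) (θ δ : ℝ)
    (ha : ∀ j < H, |(fwdDiff 1)^[d] a j - θ| ≤ δ) :
    ∃ (b : ℕ → UnitAddCircle) (r : ℕ → ℝ), ∀ j < H,
      (a j : UnitAddCircle) = polySeq d b θ j + (r j : UnitAddCircle) ∧ |r j| ≤ H ^ d * δ := by
  induction d generalizing a with
  | zero =>
    refine ⟨0, fun j => a j - θ, fun j hj => ⟨?_, by simpa using ha j hj⟩⟩
    rw [polySeq, ← AddCircle.coe_add]; congr 1; ring
  | succ d ih =>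
    obtain ⟨b, r, hbr⟩ := ih (fwdDiff 1 a) ha
    -- The new coefficient is the initial value of the sequence. The errors of the difference
    -- sequence add up over fewer than H terms, which costs one factor H.
    refine ⟨fun i => Nat.casesOn i (a 0 : UnitAddCircle) b, fun j => ∑ i ∈ Finset.range j, r i,
      fun j hj => ⟨?_, ?_⟩⟩
    · have h1 : a j = a 0 + ∑ i ∈ Finset.range j, fwdDiff 1 a i := by
        simp only [fwdDiff]
        rw [Finset.sum_range_sub]; ring
      have hcoe : ∀ (s : Finset ℕ) (g : ℕ → ℝ),
          ((∑ i ∈ s, g i : ℝ) : UnitAddCircle) = ∑ i ∈ s, (g i : UnitAddCircle) :=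
        fun s g => map_sum (QuotientAddGroup.mk' (AddSubgroup.zmultiples (1 : ℝ))) g s
      rw [h1, AddCircle.coe_add, hcoe, hcoe, polySeq, add_assoc, ← Finset.sum_add_distrib]
      congr 1
      exact Finset.sum_congr rfl fun i hi => (hbr i ((Finset.mem_range.mp hi).trans hj)).1
    · have hδ : 0 ≤ (H : ℝ) ^ d * δ := (abs_nonneg _).trans (hbr j hj).2
      calc |∑ i ∈ Finset.range j, r i| ≤ ∑ i ∈ Finset.range j, (H : ℝ) ^ d * δ :=
            (Finset.abs_sum_le_sum_abs _ _).trans <| Finset.sum_le_sum fun i hi =>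
              (hbr i ((Finset.mem_range.mp hi).trans hj)).2
        _ = j * (H ^ d * δ) := by simp
        _ ≤ H * (H ^ d * δ) := by
            have : (j : ℝ) ≤ H := by exact_mod_cast hj.le
            gcongr
        _ = _ := by ring

/-- The largest modulus of a normalized exponential sum of length `H` along a sequence with constant
`d`-th difference `θ`. -/
def weylSup (d H : ℕ) (θ : UnitAddCircle) : ℝ :=
  sSup ((fun b => ‖∑ j ∈ Finset.range H, circleChar (polySeq d b θ j)‖ / H) '' Set.univ)

lemma norm_sum_polySeq_div_le_one (d H : ℕ) (b : ℕ → UnitAddCircle) (θ : UnitAddCircle) :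
    ‖∑ j ∈ Finset.range H, circleChar (polySeq d b θ j)‖ / H ≤ 1 := by
  refine div_le_one_of_le₀ ?_ (Nat.cast_nonneg _)
  simpa using norm_sum_circleChar_le (Finset.range H) (polySeq d b θ)

/-- A jointly continuous function has a continuous supremum over a compact parameter space; here the
coefficients form the product ℕ → circle, compact by Tychonoff. -/
lemma continuous_weylSup (d H : ℕ) : Continuous (weylSup d H) := by
  refine isCompact_univ.continuous_sSup (f := fun (θ : UnitAddCircle) (b : ℕ → UnitAddCircle) =>
    ‖∑ j ∈ Finset.range H, circleChar (polySeq d b θ j)‖ / H) ?_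
  refine Continuous.div_const (Continuous.norm (continuous_finsetSum _ fun j _ => ?_)) _
  exact continuous_circleChar.comp (continuous_polySeq d j)

lemma weylSup_nonneg (d H : ℕ) (θ : UnitAddCircle) : 0 ≤ weylSup d H θ := by
  refine Real.sSup_nonneg ?_
  rintro _ ⟨b, -, rfl⟩
  positivity

lemma weylSup_le_one (d H : ℕ) (θ : UnitAddCircle) : weylSup d H θ ≤ 1 := by
  refine Real.sSup_le ?_ zero_le_one
  rintro _ ⟨b, -, rfl⟩
  exact norm_sum_polySeq_div_le_one d H b θ

/-- The threshold in Weyl's theorem does not depend on the coefficients, so the bound passes to the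
supremum. For d = 0 the sequences are constant and no decay occurs. -/
lemma tendsto_weylSup (d : ℕ) (hd : 1 ≤ d) {θ : UnitAddCircle} (hθ : ¬ IsOfFinAddOrder θ) :
    Tendsto (fun H => weylSup d H θ) atTop (𝓝 0) := by
  obtain ⟨d, rfl⟩ := Nat.exists_eq_add_of_le' hd
  refine squeeze_zero_norm' (a := fun H => |weylSup (d + 1) H θ|) (by simp) ?_
  rw [Metric.tendsto_atTop]
  intro ε hε
  obtain ⟨N₀, hN₀⟩ := exists_forall_norm_sum_circleChar_le d hθ (half_pos hε)
  refine ⟨N₀, fun N hN => ?_⟩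
  rw [Real.dist_0_eq_abs, abs_abs, abs_of_nonneg (weylSup_nonneg _ _ _)]
  refine lt_of_le_of_lt (Real.sSup_le ?_ (half_pos hε).le) (half_lt_self hε)
  rintro _ ⟨b, -, rfl⟩
  exact div_le_of_le_mul₀ (Nat.cast_nonneg _) (half_pos hε).le
    (hN₀ N hN _ fun j => fwdDiff_iter_polySeq _ _ _ _)

/-- The sequence is within H^d δ of some `polySeq` mod 1, and the character is 2π-Lipschitz. -/
lemma norm_sum_circleChar_le_weylSup (d H : ℕ) (a : ℕ → ℝ) (θ δ : ℝ)
    (ha : ∀ j < H, |(fwdDiff 1)^[d] a j - θ| ≤ δ) :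
    ‖∑ j ∈ Finset.range H, circleChar (a j : UnitAddCircle)‖
      ≤ H * (weylSup d H θ + 2 * Real.pi * (H ^ d * δ)) := by
  rcases Nat.eq_zero_or_pos H with rfl | hH
  · simp
  have hH' : (0 : ℝ) < H := by exact_mod_cast hH
  obtain ⟨b, r, hbr⟩ := exists_polySeq_approx d H a θ δ ha
  have h1 : ‖∑ j ∈ Finset.range H, circleChar (polySeq d b θ j)‖ ≤ H * weylSup d H θ := by
    rw [← div_le_iff₀' hH']
    refine le_csSup ⟨1, ?_⟩ ⟨b, trivial, rfl⟩
    rintro _ ⟨b, -, rfl⟩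
    exact norm_sum_polySeq_div_le_one d H b θ
  have h2 : ‖∑ j ∈ Finset.range H, circleChar (a j : UnitAddCircle)
      - ∑ j ∈ Finset.range H, circleChar (polySeq d b θ j)‖
      ≤ H * (2 * Real.pi * (H ^ d * δ)) := by
    rw [← Finset.sum_sub_distrib]
    calc _ ≤ ∑ j ∈ Finset.range H, 2 * Real.pi * ((H : ℝ) ^ d * δ) := by
          refine norm_sum_le_of_le _ fun j hj => ?_
          obtain ⟨h3, h4⟩ := hbr j (Finset.mem_range.mp hj)
          rw [h3, circleChar_add, ← mul_sub_one, norm_mul, norm_circleChar, one_mul]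
          exact (norm_circleChar_coe_sub_one_le _).trans (by gcongr)
      _ = _ := by simp
  calc _ ≤ ‖∑ j ∈ Finset.range H, circleChar (polySeq d b θ j)‖ + _ :=
        norm_le_insert' _ _
    _ ≤ _ := add_le_add h1 h2
    _ = _ := by ring

/-! ### Finite differences and directional derivatives -/

/-- Differences of a function approximate its derivatives. -/
lemma abs_fwdDiff_iter_sub_le (d : ℕ) (h : ℕ → ℝ → ℝ) (θ δ : ℝ) (j : ℕ)
    (hder : ∀ i < d, ∀ t ∈ Set.Icc (j : ℝ) (j + d), HasDerivAt (h i) (h (i + 1) t) t)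
    (hθ : ∀ t ∈ Set.Icc (j : ℝ) (j + d), |h d t - θ| ≤ δ) :
    |(fwdDiff 1)^[d] (fun i : ℕ => h 0 i) j - θ| ≤ δ := by
  induction d generalizing h with
  | zero => simpa using hθ j (by simp)
  | succ d ih =>
    have hmem : ∀ t ∈ Set.Icc (j : ℝ) (j + d), ∀ s ∈ Set.Icc t (t + 1),
        s ∈ Set.Icc (j : ℝ) (j + (d + 1 : ℕ)) := by
      intro t ht s hs
      push_cast
      exact ⟨ht.1.trans hs.1, by linarith [hs.2, ht.2]⟩
    -- Differencing the whole tower of derivatives lowers the order by one; the mean value theorem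
    -- turns the top difference h d (t + 1) - h d t into a value of h (d + 1).
    have := ih (fun i t => h i (t + 1) - h i t) ?_ ?_
    · rw [Function.iterate_succ_apply]
      convert this using 5
      simp [fwdDiff]
    · intro i hi t ht
      refine HasDerivAt.sub ?_ (hder i (hi.trans (Nat.lt_succ_self d)) t (hmem t ht t (by simp)))
      exact HasDerivAt.comp_add_const t 1
        (hder i (hi.trans (Nat.lt_succ_self d)) (t + 1) (hmem t ht _ (by simp)))
    · intro t ht
      obtain ⟨c, hc, hc'⟩ := exists_hasDerivAt_eq_slope (h d) (h (d + 1)) (lt_add_one t)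
        (fun s hs => (hder d (Nat.lt_succ_self d) s (hmem t ht s hs)).continuousAt.continuousWithinAt)
        (fun s hs => hder d (Nat.lt_succ_self d) s (hmem t ht s ⟨hs.1.le, hs.2.le⟩))
      simp only [add_sub_cancel_left, div_one] at hc'
      rw [← hc']
      exact hθ c (hmem t ht c ⟨hc.1.le, hc.2.le⟩)

section Derivatives

variable {n : ℕ} {C : Set (E n)} {f : E n → ℝ}

lemma iterDirDeriv_succ (v : E n) (d : ℕ) (f : E n → ℝ) :
    iterDirDeriv C v (d + 1) f = fun x => fderivWithin ℝ (iterDirDeriv C v d f) C x v := by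
  rw [iterDirDeriv, Function.iterate_succ_apply']
  rfl

/-- At interior points the derivative within `C` is the ordinary one, so smoothness survives the
recursion there. -/
lemma contDiffOn_iterDirDeriv (hf : ContDiffOn ℝ ∞ f C) (v : E n) (d : ℕ) :
    ContDiffOn ℝ ∞ (iterDirDeriv C v d f) (interior C) := by
  induction d with
  | zero => exact hf.mono interior_subset
  | succ d ih =>
    rw [iterDirDeriv_succ]
    have h1 : ContDiffOn ℝ ∞ (fun x => fderiv ℝ (iterDirDeriv C v d f) x v) (interior C) :=
      (ih.fderiv_of_isOpen isOpen_interior (by simp)).clm_apply contDiffOn_const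
    exact h1.congr fun x hx => by
      rw [fderivWithin_of_mem_nhds (mem_interior_iff_mem_nhds.mp hx)]

lemma hasDerivAt_iterDirDeriv (hf : ContDiffOn ℝ ∞ f C) (v p : E n) (d : ℕ) {t : ℝ}
    (ht : p + t • v ∈ interior C) :
    HasDerivAt (fun t : ℝ => iterDirDeriv C v d f (p + t • v))
      (iterDirDeriv C v (d + 1) f (p + t • v)) t := by
  have h1 : DifferentiableAt ℝ (iterDirDeriv C v d f) (p + t • v) :=
    ((contDiffOn_iterDirDeriv hf v d).contDiffAt (isOpen_interior.mem_nhds ht)).differentiableAt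
      (by simp)
  have h2 : HasDerivAt (fun t : ℝ => p + t • v) v t := by
    simpa using ((hasDerivAt_id t).smul_const v).const_add p
  rw [iterDirDeriv_succ]
  simp only [fderivWithin_of_mem_nhds (mem_interior_iff_mem_nhds.mp ht)]
  exact h1.hasFDerivAt.comp_hasDerivAt t h2

end Derivatives

/-! ### Counting integer points and Riemann sums over cones -/

section LatticePoints

open scoped Pointwise

variable {n : ℕ}

lemma intVec_add (v w : Fin n → ℤ) : intVec (v + w) = intVec v + intVec w := by
  ext i; simp [intVec]

lemma intVec_nsmul (j : ℕ) (v : Fin n → ℤ) : intVec (j • v) = (j : ℝ) • intVec v := by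
  ext i; simp [intVec]

/-- Puts the integer points in the form used by `tendsto_tsum_div_pow_atTop_integral`. -/
lemma range_intVec_eq : Set.range (intVec (n := n)) =
    (EuclideanSpace.equiv (Fin n) ℝ) ⁻¹'
      (Submodule.span ℤ (Set.range (Pi.basisFun ℝ (Fin n))) : Set (Fin n → ℝ)) := by
  ext x
  simp only [Set.mem_range, Set.mem_preimage, SetLike.mem_coe,
    Module.Basis.mem_span_iff_repr_mem, Pi.basisFun_repr]
  constructor
  · rintro ⟨v, rfl⟩ i
    exact ⟨v i, by simp [intVec]⟩
  · intro h
    choose v hv using h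
    exact ⟨v, by ext i; simpa [intVec] using hv i⟩

/-- The integer points `p` with `p / N ∈ D`, rescaled, in the coordinates used by Mathlib. -/
lemma exists_equiv_rescaled (D : Set (E n)) {R : ℝ} (hR : R ≠ 0) :
    ∃ e : {p : E n | p ∈ Set.range (intVec (n := n)) ∧ R⁻¹ • p ∈ D} ≃
      ↑(((EuclideanSpace.equiv (Fin n) ℝ).symm ⁻¹' D) ∩ R⁻¹ •
        (Submodule.span ℤ (Set.range (Pi.basisFun ℝ (Fin n))) : Set (Fin n → ℝ))),
      ∀ p, (e p : Fin n → ℝ) = EuclideanSpace.equiv (Fin n) ℝ (R⁻¹ • (p : E n)) := by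
  have hR' : R⁻¹ ≠ 0 := inv_ne_zero hR
  refine ⟨Equiv.ofBijective (fun p => ⟨EuclideanSpace.equiv (Fin n) ℝ (R⁻¹ • (p : E n)), ?_, ?_⟩)
    ⟨?_, ?_⟩, fun p => rfl⟩
  · simpa using p.2.2
  · rw [map_smul]
    exact Set.smul_mem_smul_set (range_intVec_eq.le p.2.1)
  · intro p q hpq
    have := (EuclideanSpace.equiv (Fin n) ℝ).injective (Subtype.ext_iff.mp hpq)
    exact Subtype.ext (smul_right_injective _ hR' this)
  · rintro ⟨_, hD, y, hy, rfl⟩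
    refine ⟨⟨(EuclideanSpace.equiv (Fin n) ℝ).symm y, ?_, ?_⟩, ?_⟩
    · rw [range_intVec_eq]; exact hy
    · simpa using hD
    · ext; simp

lemma finite_rescaled {D : Set (E n)} (hD : Bornology.IsBounded D) {R : ℝ} (hR : R ≠ 0) :
    {p : E n | p ∈ Set.range (intVec (n := n)) ∧ R⁻¹ • p ∈ D}.Finite := by
  obtain ⟨r, hr⟩ := hD.subset_closedBall 0
  have h2 : {v : Fin n → ℤ | R⁻¹ • intVec v ∈ D}.Finite := by
    refine (Set.Finite.pi' (t := fun _ : Fin n => {k : ℤ | (k : ℝ) ∈ Set.Icc (-(r * |R|)) (r * |R|)})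
      fun i => ?_).subset ?_
    · refine (Set.finite_Icc (⌈-(r * |R|)⌉) (⌊r * |R|⌋)).subset fun k hk => ?_
      exact ⟨Int.ceil_le.mpr hk.1, Int.le_floor.mpr hk.2⟩
    · intro v hv i
      have h1 : ‖R⁻¹ • intVec v‖ ≤ r := by simpa using hr hv
      have h3 : ‖(intVec v) i‖ ≤ ‖intVec v‖ := PiLp.norm_apply_le _ i
      rw [norm_smul, norm_inv, inv_mul_le_iff₀ (norm_pos_iff.mpr hR)] at h1
      have h4 : |(v i : ℝ)| ≤ r * |R| := by
        simpa [intVec, mul_comm] using h3.trans h1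
      exact abs_le.mp h4
  refine (h2.image intVec).subset ?_
  rintro _ ⟨⟨v, rfl⟩, hv⟩
  exact ⟨v, hv, rfl⟩

/-- Sets invariant under positive dilations. -/
def IsDilationInvariant (C : Set (E n)) : Prop := ∀ x ∈ C, ∀ r : ℝ, 0 < r → r • x ∈ C

lemma IsDilationInvariant.smul_mem_iff {C : Set (E n)} (hC : IsDilationInvariant C) {r : ℝ}
    (hr : 0 < r) {x : E n} : r • x ∈ C ↔ x ∈ C := by
  refine ⟨fun h => ?_, fun h => hC x h r hr⟩
  simpa [smul_smul, inv_mul_cancel₀ hr.ne'] using hC _ h r⁻¹ (inv_pos.mpr hr)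

lemma IsDilationInvariant.interior {C : Set (E n)} (hC : IsDilationInvariant C) :
    IsDilationInvariant (interior C) := by
  intro x hx r hr
  have h1 : r • C = C := by
    ext y
    rw [Set.mem_smul_set_iff_inv_smul_mem₀ hr.ne', hC.smul_mem_iff (inv_pos.mpr hr)]
  have h2 := Set.smul_mem_smul_set (a := r) hx
  rwa [← interior_smul₀ hr.ne', h1] at h2

lemma latticePoints_eq {C : Set (E n)} (hC : IsDilationInvariant C) {R : ℝ} (hR : 0 < R) :
    latticePoints C R =
      {p : E n | p ∈ Set.range (intVec (n := n)) ∧ R⁻¹ • p ∈ C ∩ ball 0 1} := by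
  ext p
  simp only [latticePoints, Set.mem_inter_iff, Set.mem_ofPred_eq, mem_ball_zero_iff,
    hC.smul_mem_iff (inv_pos.mpr hR), norm_smul, norm_inv, Real.norm_of_nonneg hR.le,
    inv_mul_lt_iff₀ hR, mul_one]

lemma latticePoints_finite (C : Set (E n)) (R : ℝ) : (latticePoints C R).Finite := by
  refine (finite_rescaled (isBounded_ball (x := (0 : E n)) (r := R)) one_ne_zero).subset ?_
  rintro p ⟨h1, -, h2⟩
  exact ⟨h1, by simpa using h2⟩

/-- The integer points of `C` in the ball of radius `R` as a `Finset`. -/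
def latticeFinset (C : Set (E n)) (R : ℝ) : Finset (E n) := (latticePoints_finite C R).toFinset

lemma mem_latticeFinset {C : Set (E n)} {R : ℝ} {p : E n} :
    p ∈ latticeFinset C R ↔ p ∈ Set.range (intVec (n := n)) ∧ p ∈ C ∧ ‖p‖ < R := by
  simp [latticeFinset, latticePoints]

lemma coe_latticeFinset (C : Set (E n)) (R : ℝ) :
    (latticeFinset C R : Set (E n)) = latticePoints C R := by
  simp [latticeFinset]

lemma volume_preserving_coords_symm :
    MeasurePreserving (EuclideanSpace.equiv (Fin n) ℝ).symm volume volume :=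
  PiLp.volume_preserving_toLp (Fin n)

section Coordinates

variable {D : Set (E n)}

lemma isBounded_coords (hD : Bornology.IsBounded D) :
    Bornology.IsBounded ((EuclideanSpace.equiv (Fin n) ℝ).symm ⁻¹' D) := by
  rw [← ContinuousLinearEquiv.image_eq_preimage_symm]
  exact (EuclideanSpace.equiv (Fin n) ℝ).lipschitz.isBounded_image hD

lemma frontier_coords (hfr : volume (frontier D) = 0) :
    volume (frontier ((EuclideanSpace.equiv (Fin n) ℝ).symm ⁻¹' D)) = 0 := by
  have h := (EuclideanSpace.equiv (Fin n) ℝ).symm.toHomeomorph.preimage_frontier D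
  simp only [ContinuousLinearEquiv.coe_toHomeomorph] at h
  rw [← h, volume_preserving_coords_symm.measure_preimage
    isClosed_frontier.measurableSet.nullMeasurableSet]
  exact hfr

lemma measurableSet_coords (hm : MeasurableSet D) :
    MeasurableSet ((EuclideanSpace.equiv (Fin n) ℝ).symm ⁻¹' D) :=
  (EuclideanSpace.equiv (Fin n) ℝ).symm.continuous.measurable hm

end Coordinates

/-- Riemann sums over the integer points of a cone. -/
theorem tendsto_sum_latticeFinset {C : Set (E n)} (hC : IsDilationInvariant C)
    (hm : MeasurableSet C) (hfr : volume (frontier (C ∩ ball 0 1)) = 0) {F : E n → ℝ}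
    (hF : Continuous F) :
    Tendsto (fun N : ℕ => (∑ p ∈ latticeFinset C N, F ((N : ℝ)⁻¹ • p)) / (N : ℝ) ^ n) atTop
      (𝓝 (∫ x in C ∩ ball 0 1, F x)) := by
  have hb : Bornology.IsBounded (C ∩ ball (0 : E n) 1) := isBounded_ball.subset Set.inter_subset_right
  have hm' : MeasurableSet (C ∩ ball (0 : E n) 1) := hm.inter measurableSet_ball
  have key := tendsto_tsum_div_pow_atTop_integral
    ((EuclideanSpace.equiv (Fin n) ℝ).symm ⁻¹' (C ∩ ball (0 : E n) 1))
    (fun y => F ((EuclideanSpace.equiv (Fin n) ℝ).symm y)) (by fun_prop)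
    (isBounded_coords hb) (measurableSet_coords hm') (frontier_coords hfr)
  rw [volume_preserving_coords_symm.setIntegral_preimage_emb
    (EuclideanSpace.equiv (Fin n) ℝ).symm.toHomeomorph.measurableEmbedding F] at key
  refine key.congr' ?_
  filter_upwards [eventually_gt_atTop 0] with N hN
  have hN' : (0 : ℝ) < N := by exact_mod_cast hN
  rw [Fintype.card_fin]
  congr 1
  obtain ⟨e, he⟩ := exists_equiv_rescaled (C ∩ ball (0 : E n) 1) hN'.ne'
  rw [← e.tsum_eq]
  simp only [he, ContinuousLinearEquiv.symm_apply_apply]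
  rw [← Finset.tsum_subtype' (latticeFinset C N) (fun p => F ((N : ℝ)⁻¹ • p)), coe_latticeFinset,
    latticePoints_eq hC hN']

/-- Counting of the integer points of a cone. -/
theorem tendsto_card_latticeFinset {C : Set (E n)} (hC : IsDilationInvariant C)
    (hm : MeasurableSet C) (hfr : volume (frontier (C ∩ ball 0 1)) = 0) :
    Tendsto (fun R : ℝ => ((latticeFinset C R).card : ℝ) / R ^ n) atTop
      (𝓝 (volume.real (C ∩ ball 0 1))) := by
  have hb : Bornology.IsBounded (C ∩ ball (0 : E n) 1) := isBounded_ball.subset Set.inter_subset_right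
  have hm' : MeasurableSet (C ∩ ball (0 : E n) 1) := hm.inter measurableSet_ball
  have key := tendsto_card_div_pow_atTop_volume'
    ((EuclideanSpace.equiv (Fin n) ℝ).symm ⁻¹' (C ∩ ball (0 : E n) 1))
    (isBounded_coords hb) (measurableSet_coords hm') (frontier_coords hfr) (by
      -- The dilates of the truncated cone increase with the factor; this monotonicity permits real
      -- radii and not only integral ones.
      intro x y hx hxy
      rintro _ ⟨z, hz, rfl⟩
      have hy : 0 < y := hx.trans_le hxy
      refine ⟨(x / y) • z, ⟨?_, ?_⟩, ?_⟩
      · rw [map_smul]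
        exact hC _ hz.1 _ (by positivity)
      · have h1 := hz.2
        rw [mem_ball_zero_iff] at h1 ⊢
        rw [map_smul, norm_smul, Real.norm_of_nonneg (by positivity)]
        exact lt_of_le_of_lt (mul_le_of_le_one_left (norm_nonneg _) ((div_le_one hy).mpr hxy)) h1
      · simp only [smul_smul]
        rw [mul_div_cancel₀ _ hy.ne'])
  have hvol : volume.real ((EuclideanSpace.equiv (Fin n) ℝ).symm ⁻¹' (C ∩ ball (0 : E n) 1))
      = volume.real (C ∩ ball (0 : E n) 1) := by
    rw [measureReal_def, volume_preserving_coords_symm.measure_preimage hm'.nullMeasurableSet,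
      measureReal_def]
  rw [hvol] at key
  refine key.congr' ?_
  filter_upwards [eventually_gt_atTop 0] with R hR
  rw [Fintype.card_fin]
  congr 2
  obtain ⟨e, he⟩ := exists_equiv_rescaled (C ∩ ball (0 : E n) 1) hR.ne'
  rw [← Nat.card_congr e, ← latticePoints_eq hC hR, ← coe_latticeFinset, Nat.card_eq_card_toFinset]
  simp

end LatticePoints

/-! ### Geometry of the cone over a spherical cap -/

variable {n : ℕ} {S : Set (sphere (0 : E n) 1)}

lemma mem_cone_iff {x : E n} :
    x ∈ cone S ↔ ∃ h : x ≠ 0, (⟨‖x‖⁻¹ • x, by simp [norm_smul, h]⟩ : sphere (0 : E n) 1) ∈ S := by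
  constructor
  · rintro ⟨r, hr, a, ha, rfl⟩
    have hn : ‖(a : E n)‖ = 1 := by simp
    have ha0 : (a : E n) ≠ 0 := norm_ne_zero_iff.mp (by rw [hn]; exact one_ne_zero)
    refine ⟨smul_ne_zero hr.ne' ha0, ?_⟩
    convert ha
    rw [norm_smul, hn, mul_one, Real.norm_of_nonneg hr.le, smul_smul, inv_mul_cancel₀ hr.ne',
      one_smul]
  · rintro ⟨h, hS⟩
    refine ⟨‖x‖, norm_pos_iff.mpr h, _, hS, ?_⟩
    rw [smul_smul, mul_inv_cancel₀ (norm_ne_zero_iff.mpr h), one_smul]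

lemma zero_notMem_cone : (0 : E n) ∉ cone S := fun h => (mem_cone_iff.mp h).1 rfl

lemma coe_mem_cone_iff (a : sphere (0 : E n) 1) : (a : E n) ∈ cone S ↔ a ∈ S := by
  have hn : ‖(a : E n)‖ = 1 := by simp
  rw [mem_cone_iff]
  constructor
  · rintro ⟨_, h⟩
    simpa [hn] using h
  · intro h
    exact ⟨norm_ne_zero_iff.mp (by rw [hn]; exact one_ne_zero), by simpa [hn] using h⟩

lemma isDilationInvariant_cone : IsDilationInvariant (cone S) := by
  rintro _ ⟨r, hr, a, ha, rfl⟩ s hs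
  exact ⟨s * r, mul_pos hs hr, a, ha, by rw [smul_smul]⟩

lemma cone_open_halfSpace (u : E n) (c : ℝ) :
    cone {x : sphere (0 : E n) 1 | c < inner ℝ u (x : E n)}
      = {x : E n | c * ‖x‖ < inner ℝ u x} \ {0} := by
  ext x
  rw [mem_cone_iff]
  simp only [Set.mem_sdiff, Set.mem_ofPred_eq, Set.mem_singleton_iff, inner_smul_right]
  refine ⟨fun ⟨h, h'⟩ => ⟨?_, h⟩, fun ⟨h', h⟩ => ⟨h, ?_⟩⟩
  · rwa [inv_mul_eq_div, lt_div_iff₀ (norm_pos_iff.mpr h)] at h'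
  · rwa [inv_mul_eq_div, lt_div_iff₀ (norm_pos_iff.mpr h)]

lemma cone_closed_halfSpace (u : E n) (c : ℝ) :
    cone {x : sphere (0 : E n) 1 | c ≤ inner ℝ u (x : E n)}
      = {x : E n | c * ‖x‖ ≤ inner ℝ u x} \ {0} := by
  ext x
  rw [mem_cone_iff]
  simp only [Set.mem_sdiff, Set.mem_ofPred_eq, Set.mem_singleton_iff, inner_smul_right]
  refine ⟨fun ⟨h, h'⟩ => ⟨?_, h⟩, fun ⟨h', h⟩ => ⟨h, ?_⟩⟩
  · rwa [inv_mul_eq_div, le_div_iff₀ (norm_pos_iff.mpr h)] at h'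
  · rwa [inv_mul_eq_div, le_div_iff₀ (norm_pos_iff.mpr h)]

/-- According to the sign of the cap's parameter, the half-cone or its complement is a sublevel set
of such a function. It is then convex, so its frontier is null. -/
lemma convexOn_mul_norm_add_inner (u : E n) {c : ℝ} (hc : 0 ≤ c) :
    ConvexOn ℝ Set.univ fun x : E n => c * ‖x‖ + inner ℝ u x :=
  (convexOn_univ_norm.smul hc).add ((innerSL ℝ u).toLinearMap.convexOn convex_univ)

lemma volume_frontier_open_halfCone (u : E n) (c : ℝ) :
    volume (frontier {x : E n | c * ‖x‖ < inner ℝ u x}) = 0 := by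
  rcases le_or_gt 0 c with hc | hc
  · have h := (convexOn_mul_norm_add_inner (-u) hc).convex_lt 0
    have e : {x : E n | c * ‖x‖ < inner ℝ u x}
        = {x | x ∈ Set.univ ∧ c * ‖x‖ + inner ℝ (-u) x < 0} := by
      ext x
      simp only [Set.mem_ofPred_eq, Set.mem_univ, true_and, inner_neg_left]
      constructor <;> intro h <;> linarith
    rw [e]
    exact h.addHaar_frontier volume
  · have h := (convexOn_mul_norm_add_inner u (neg_nonneg.mpr hc.le)).convex_le 0
    have e : {x : E n | c * ‖x‖ < inner ℝ u x}ᶜ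
        = {x | x ∈ Set.univ ∧ -c * ‖x‖ + inner ℝ u x ≤ 0} := by
      ext x
      simp only [Set.mem_compl_iff, Set.mem_ofPred_eq, Set.mem_univ, true_and, not_lt]
      constructor <;> intro h <;> linarith
    rw [← frontier_compl, e]
    exact h.addHaar_frontier volume

lemma volume_frontier_closed_halfCone (u : E n) (c : ℝ) :
    volume (frontier {x : E n | c * ‖x‖ ≤ inner ℝ u x}) = 0 := by
  rcases le_or_gt 0 c with hc | hc
  · have h := (convexOn_mul_norm_add_inner (-u) hc).convex_le 0
    have e : {x : E n | c * ‖x‖ ≤ inner ℝ u x}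
        = {x | x ∈ Set.univ ∧ c * ‖x‖ + inner ℝ (-u) x ≤ 0} := by
      ext x
      simp only [Set.mem_ofPred_eq, Set.mem_univ, true_and, inner_neg_left]
      constructor <;> intro h <;> linarith
    rw [e]
    exact h.addHaar_frontier volume
  · have h := (convexOn_mul_norm_add_inner u (neg_nonneg.mpr hc.le)).convex_lt 0
    have e : {x : E n | c * ‖x‖ ≤ inner ℝ u x}ᶜ
        = {x | x ∈ Set.univ ∧ -c * ‖x‖ + inner ℝ u x < 0} := by
      ext x
      simp only [Set.mem_compl_iff, Set.mem_ofPred_eq, Set.mem_univ, true_and, not_le]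
      constructor <;> intro h <;> linarith
    rw [← frontier_compl, e]
    exact h.addHaar_frontier volume

lemma IsSphericalCap.nontrivial (hS : IsSphericalCap S) : Nontrivial (E n) := by
  obtain ⟨u, -, hu, -⟩ := hS
  exact nontrivial_of_ne u 0 (norm_ne_zero_iff.mp (by rw [hu]; exact one_ne_zero))

lemma volume_frontier_diff_zero [Nontrivial (E n)] {K : Set (E n)} (hK : volume (frontier K) = 0) :
    volume (frontier (K \ {0})) = 0 := by
  refine measure_mono_null (t := frontier K ∪ {0}) ?_ (measure_union_null hK (by simp))
  rw [Set.sdiff_eq]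
  refine (frontier_inter_subset K {0}ᶜ).trans (Set.union_subset_union Set.inter_subset_left ?_)
  rw [frontier_compl]
  exact Set.inter_subset_right.trans (isClosed_singleton.frontier_subset)

lemma IsSphericalCap.volume_frontier_cone (hS : IsSphericalCap S) :
    volume (frontier (cone S)) = 0 := by
  have := hS.nontrivial
  obtain ⟨u, c, -, -, rfl | rfl⟩ := hS
  · rw [cone_open_halfSpace]
    exact volume_frontier_diff_zero (volume_frontier_open_halfCone u c)
  · rw [cone_closed_halfSpace]
    exact volume_frontier_diff_zero (volume_frontier_closed_halfCone u c)

lemma IsSphericalCap.measurableSet_cone (hS : IsSphericalCap S) : MeasurableSet (cone S) := by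
  obtain ⟨u, c, -, -, rfl | rfl⟩ := hS
  · rw [cone_open_halfSpace]
    exact (measurableSet_lt (by fun_prop) (by fun_prop)).diff (measurableSet_singleton 0)
  · rw [cone_closed_halfSpace]
    exact (measurableSet_le (by fun_prop) (by fun_prop)).diff (measurableSet_singleton 0)

lemma IsSphericalCap.measurableSet (hS : IsSphericalCap S) : MeasurableSet S := by
  have : S = Subtype.val ⁻¹' (cone S) := by
    ext a; exact (coe_mem_cone_iff a).symm
  rw [this]
  exact measurable_subtype_coe hS.measurableSet_cone

lemma IsSphericalCap.interior_cone_inter_ball_nonempty (hS : IsSphericalCap S) :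
    (interior (cone S) ∩ ball 0 1).Nonempty := by
  obtain ⟨u, c, hu, hc, hS⟩ := hS
  have hu0 : u ≠ 0 := norm_ne_zero_iff.mp (by rw [hu]; exact one_ne_zero)
  have hopen : IsOpen ({x : E n | c * ‖x‖ < inner ℝ u x} \ {0}) :=
    (isOpen_lt (by fun_prop) (by fun_prop)).sdiff isClosed_singleton
  have hsub : {x : E n | c * ‖x‖ < inner ℝ u x} \ {0} ⊆ cone S := by
    rcases hS with rfl | rfl
    · rw [cone_open_halfSpace]
    · rw [cone_closed_halfSpace]
      rintro x ⟨hx, hx0⟩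
      simp only [Set.mem_ofPred_eq] at hx
      exact ⟨by simpa using hx.le, hx0⟩
  -- The axis of the cone lies in the open half-cone because c < 1; halving u brings it into the
  -- open ball.
  refine ⟨(2⁻¹ : ℝ) • u, isDilationInvariant_cone.interior u ?_ _ (by norm_num), ?_⟩
  · refine interior_maximal hsub hopen ⟨?_, hu0⟩
    simpa [hu] using hc
  · simp only [mem_ball_zero_iff, norm_smul, hu]
    norm_num

lemma IsSphericalCap.volume_cone_inter_ball_pos (hS : IsSphericalCap S) :
    0 < volume.real (cone S ∩ ball 0 1) := by
  refine lt_of_lt_of_le (b := volume.real (interior (cone S) ∩ ball 0 1)) ?_ ?_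
  · exact ENNReal.toReal_pos ((isOpen_interior.inter isOpen_ball).measure_pos _
      hS.interior_cone_inter_ball_nonempty).ne'
      (measure_lt_top_of_subset Set.inter_subset_right measure_ball_lt_top.ne).ne
  · exact measureReal_mono (Set.inter_subset_inter_left _ interior_subset)
      (measure_lt_top_of_subset Set.inter_subset_right measure_ball_lt_top.ne).ne

lemma volume_frontier_inter_ball {C : Set (E n)} (hC : volume (frontier C) = 0) :
    volume (frontier (C ∩ ball 0 1)) = 0 := by
  refine measure_mono_null (t := frontier C ∪ sphere 0 1) ?_
    (measure_union_null hC (Measure.addHaar_sphere_of_ne_zero _ _ one_ne_zero))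
  refine (frontier_inter_subset _ _).trans (Set.union_subset_union Set.inter_subset_left ?_)
  exact Set.inter_subset_right.trans frontier_ball_subset_sphere

/-! ### Polar integration and the distribution of the homogeneous derivative -/

/-- Polar coordinates for dilation invariant functions. -/
lemma setIntegral_ball_of_dilationInvariant [Nontrivial (E n)] (G : E n → ℝ)
    (hG : ∀ x, ∀ r : ℝ, 0 < r → G (r • x) = G x) :
    ∫ x in ball (0 : E n) 1, G x
      = (n : ℝ)⁻¹ * ∫ a, G (a : E n) ∂(volume : Measure (E n)).toSphere := by
  have hn : 0 < n := by
    have := Module.finrank_pos (R := ℝ) (M := E n)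
    simpa using this
  have h1 : ∫ x in ball (0 : E n) 1, G x
      = ∫ p, G (p.1 : E n) * (Set.Iio (⟨1, Set.mem_Ioi.mpr one_pos⟩ : Set.Ioi (0 : ℝ))).indicator 1 p.2
        ∂((volume : Measure (E n)).toSphere.prod (Measure.volumeIoiPow (n - 1))) := by
    set I : Set (Set.Ioi (0 : ℝ)) := Set.Iio ⟨1, Set.mem_Ioi.mpr one_pos⟩ with hI
    have hmp := (volume : Measure (E n)).measurePreserving_homeomorphUnitSphereProd
    rw [finrank_euclideanSpace_fin] at hmp
    rw [← hmp.integral_comp (homeomorphUnitSphereProd (E n)).measurableEmbedding]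
    have hcongr : ∀ x : ({0}ᶜ : Set (E n)),
        G ((homeomorphUnitSphereProd (E n) x).1 : E n) *
            I.indicator 1 (homeomorphUnitSphereProd (E n) x).2
          = (ball (0 : E n) 1).indicator G (x : E n) := by
      intro x
      have hx : 0 < ‖(x : E n)‖ := norm_pos_iff.mpr x.2
      have h2 : (homeomorphUnitSphereProd (E n) x).2 ∈ I ↔ (x : E n) ∈ ball (0 : E n) 1 := by
        rw [hI, mem_ball_zero_iff, Set.mem_Iio, ← Subtype.coe_lt_coe]
        simp
      by_cases hb : (x : E n) ∈ ball (0 : E n) 1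
      · rw [Set.indicator_of_mem hb, Set.indicator_of_mem (h2.mpr hb)]
        simp [hG _ _ (inv_pos.mpr hx)]
      · rw [Set.indicator_of_notMem hb, Set.indicator_of_notMem (mt h2.mp hb), mul_zero]
    simp only [hcongr]
    rw [integral_subtype_comap (measurableSet_singleton (0 : E n)).compl
      ((ball (0 : E n) 1).indicator G), restrict_compl_singleton, integral_indicator measurableSet_ball]
  rw [h1, integral_prod_mul (fun a : sphere (0 : E n) 1 => G a)
    ((Set.Iio (⟨1, Set.mem_Ioi.mpr one_pos⟩ : Set.Ioi (0 : ℝ))).indicator (1 : Set.Ioi (0 : ℝ) → ℝ)), mul_comm]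
  congr 1
  -- The interval (0, 1) has mass 1 / n for the radial measure r^(n-1) dr.
  rw [integral_indicator_one measurableSet_Iio, measureReal_def, Measure.volumeIoiPow_apply_Iio]
  have : ((n - 1 : ℕ) : ℝ) + 1 = n := by
    rw [Nat.cast_sub hn]; simp
  rw [this, one_pow, ENNReal.toReal_ofReal (by positivity), one_div]

/-- Averages over a cone of a continuous function of a dilation invariant function. -/
lemma setIntegral_cone_eq_mul_integral (hS : IsSphericalCap S) (g : E n → ℝ)
    (hg : ∀ x ∈ cone S, ∀ s : ℝ, 0 < s → g (s • x) = g x)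
    {μ : Measure UnitAddCircle} [IsProbabilityMeasure μ]
    (hμ : (capMeasure S).map (modOne fun x : sphere (0 : E n) 1 => g x) = μ)
    {Φ : UnitAddCircle → ℝ} (hΦ : Continuous Φ) :
    ∫ x in interior (cone S) ∩ ball 0 1, Φ (g x)
      = volume.real (cone S ∩ ball 0 1) * ∫ y, Φ y ∂μ := by
  have := hS.nontrivial
  -- Measurability is automatic: otherwise the push-forward would be the default value 0, not a
  -- probability measure.
  have hae : AEMeasurable (modOne fun x : sphere (0 : E n) 1 => g x) (capMeasure S) := by
    by_contra h
    rw [Measure.map_of_not_aemeasurable h] at hμ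
    exact IsProbabilityMeasure.ne_zero μ hμ.symm
  have hset : (interior (cone S) ∩ ball 0 1 : Set (E n)) =ᵐ[volume] (cone S ∩ ball 0 1 : Set (E n)) :=
    (interior_ae_eq_of_null_frontier hS.volume_frontier_cone).inter (ae_eq_refl _)
  have hpolar : ∀ G : E n → ℝ, (∀ x ∈ cone S, ∀ s : ℝ, 0 < s → G (s • x) = G x) →
      ∫ x in cone S ∩ ball 0 1, G x = (n : ℝ)⁻¹ *
        ∫ a in S, G (a : E n) ∂(volume : Measure (E n)).toSphere := by
    intro G hG
    have h := setIntegral_ball_of_dilationInvariant ((cone S).indicator G) (by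
      intro x r hr
      by_cases hx : x ∈ cone S
      · rw [Set.indicator_of_mem hx, Set.indicator_of_mem (isDilationInvariant_cone x hx r hr),
          hG x hx r hr]
      · rw [Set.indicator_of_notMem hx, Set.indicator_of_notMem
          (mt (isDilationInvariant_cone.smul_mem_iff hr).mp hx)])
    rw [setIntegral_indicator hS.measurableSet_cone, Set.inter_comm] at h
    rw [h, ← integral_indicator hS.measurableSet]
    refine congrArg _ (integral_congr_ae (.of_forall fun a => ?_))
    by_cases ha : a ∈ S
    · simp only [Set.indicator_of_mem ha, Set.indicator_of_mem ((coe_mem_cone_iff a).mpr ha)]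
    · simp only [Set.indicator_of_notMem ha,
        Set.indicator_of_notMem (mt (coe_mem_cone_iff a).mp ha)]
  rw [setIntegral_congr_set hset, hpolar _ fun x hx s hs => by rw [hg x hx s hs], ← hμ,
    integral_map hae hΦ.aestronglyMeasurable]
  -- The constant function shows that the truncated cone has volume 1 / n times the mass of the cap,
  -- so the normalization of `capMeasure` cancels.
  have hvol := hpolar (fun _ => 1) fun _ _ _ _ => rfl
  simp only [setIntegral_const, smul_eq_mul, mul_one] at hvol
  have hpos := hS.volume_cone_inter_ball_pos.ne'
  rw [capMeasure, ProbabilityTheory.cond, integral_smul_measure, smul_eq_mul, hvol,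
    ENNReal.toReal_inv, ← measureReal_def]
  have hS0 : (volume : Measure (E n)).toSphere.real S ≠ 0 := fun h => hpos (by rw [hvol, h, mul_zero])
  field_simp
  rfl

/-! ### Shifts of lattice sums and the boundary layer -/

lemma norm_sum_sub_sum_shift_le (L : Finset (E n)) (u : E n → ℂ) (hu : ∀ p, ‖u p‖ ≤ 1) (w : E n)
    (B : Finset (E n)) (hB : ∀ p ∈ L, p ∉ B → p + w ∈ L) :
    ‖∑ p ∈ L, u p - ∑ p ∈ L, u (p + w)‖ ≤ 2 * B.card := by
  classical
  set L' := L.map (addRightEmbedding w) with hL'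
  have hsum : ∑ p ∈ L, u (p + w) = ∑ q ∈ L', u q := by
    rw [hL', Finset.sum_map]; rfl
  have hle : ∀ s : Finset (E n), ‖∑ p ∈ s, u p‖ ≤ s.card := fun s =>
    (norm_sum_le_of_le s fun p _ => hu p).trans (by simp)
  have hcard : (L' \ L).card ≤ B.card := by
    refine Finset.card_le_card_of_injOn (fun q => q - w) ?_ (fun x _ y _ h => sub_left_injective h)
    intro q hq
    obtain ⟨hq1, hq2⟩ := Finset.mem_sdiff.mp hq
    obtain ⟨p, hp, rfl⟩ := Finset.mem_map.mp hq1
    simp only [addRightEmbedding_apply, add_sub_cancel_right]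
    by_contra hpB
    exact hq2 (hB p hp hpB)
  -- `L` and its translate have the same size, so each misses equally many points of the other, at
  -- most the size of `B`.
  have hcard' : (L \ L').card = (L' \ L).card :=
    Finset.card_sdiff_comm (by rw [hL', Finset.card_map])
  have hcard2 : ((L' \ L).card : ℝ) ≤ B.card := by exact_mod_cast hcard
  rw [hsum, ← Finset.sum_sdiff_sub_sum_sdiff]
  calc _ ≤ ((L \ L').card : ℝ) + (L' \ L).card :=
        (norm_sub_le _ _).trans (add_le_add (hle _) (hle _))
    _ ≤ _ := by rw [hcard']; linarith

section Boundary

variable {O : Set (E n)}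

/-- The distance to the complement of the part of `O` in the open unit ball. -/
def boundaryDist (O : Set (E n)) (x : E n) : ℝ := infDist x (O ∩ ball 0 1)ᶜ

lemma continuous_boundaryDist : Continuous (boundaryDist O) := continuous_infDist_pt _

lemma boundaryDist_nonneg (x : E n) : 0 ≤ boundaryDist O x := infDist_nonneg

lemma boundaryDist_eq_zero {x : E n} (hx : x ∉ O ∩ ball 0 1) : boundaryDist O x = 0 :=
  infDist_zero_of_mem hx

lemma boundaryDist_pos (hO : IsOpen O) (h0 : (0 : E n) ∉ O) {x : E n} (hx : x ∈ O ∩ ball 0 1) :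
    0 < boundaryDist O x :=
  -- The origin makes the complement nonempty; the distance to an empty set would be the default
  -- value 0.
  ((hO.inter isOpen_ball).isClosed_compl.notMem_iff_infDist_pos ⟨0, fun h => h0 h.1⟩).mp
    (fun h => h hx)

/-- Points far from the boundary of `O` stay in `O` under small translations. -/
lemma add_mem_of_le_boundaryDist (hinv : IsDilationInvariant O) (h0 : (0 : E n) ∉ O) {N η : ℝ}
    (hN : 0 < N) {p w : E n} (hp : η ≤ boundaryDist O (N⁻¹ • p)) (hw : ‖w‖ < η * N) :
    p + w ∈ O ∧ ‖p + w‖ < N ∧ η * N - ‖w‖ ≤ ‖p + w‖ := by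
  have h1 : N⁻¹ • (p + w) ∈ O ∩ ball 0 1 := by
    by_contra h
    have h2 : boundaryDist O (N⁻¹ • p) ≤ dist (N⁻¹ • p) (N⁻¹ • (p + w)) := infDist_le_dist_of_mem h
    rw [dist_eq_norm, ← smul_sub, norm_smul, norm_inv, Real.norm_of_nonneg hN.le, sub_add_cancel_left,
      norm_neg] at h2
    have h3 := hp.trans h2
    rw [inv_mul_eq_div, le_div_iff₀ hN] at h3
    linarith
  refine ⟨(hinv.smul_mem_iff (inv_pos.mpr hN)).mp h1.1, ?_, ?_⟩
  · have := h1.2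
    rwa [mem_ball_zero_iff, norm_smul, norm_inv, Real.norm_of_nonneg hN.le, inv_mul_lt_iff₀ hN,
      mul_one] at this
  -- The origin belongs to the complement, so distance from the boundary also bounds the norm from
  -- below. This places whole segments where the (d + 1)-st derivative is small.
  · have h2 : boundaryDist O (N⁻¹ • p) ≤ dist (N⁻¹ • p) 0 :=
      infDist_le_dist_of_mem (fun h => h0 h.1)
    rw [dist_zero_right, norm_smul, norm_inv, Real.norm_of_nonneg hN.le] at h2
    have h3 := hp.trans h2
    rw [inv_mul_eq_div, le_div_iff₀ hN] at h3
    have h4 : ‖p‖ ≤ ‖p + w‖ + ‖w‖ := by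
      simpa using norm_sub_le (p + w) w
    linarith

/-- The integrand tends to 0 at every point of the open set as η → 0. It is a continuous majorant
for counting by Riemann sums: the width 2η makes it at least 1/2 where the distance is below η. -/
lemma exists_setIntegral_boundaryLayer_lt (hO : IsOpen O) (h0 : (0 : E n) ∉ O) {ε : ℝ} (hε : 0 < ε) :
    ∃ η : ℝ, 0 < η ∧
      ∫ x in O ∩ ball 0 1, max 0 (1 - boundaryDist O x / (2 * η)) < ε := by
  have hlim : Tendsto (fun m : ℕ => ∫ x in O ∩ ball 0 1,
      max 0 (1 - boundaryDist O x / (2 * ((m : ℝ) + 1)⁻¹))) atTop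
      (𝓝 (∫ x in O ∩ ball (0 : E n) 1, (0 : ℝ))) := by
    refine tendsto_integral_of_dominated_convergence (fun _ => 1) (fun m => ?_) ?_ (fun m => ?_) ?_
    · exact Continuous.aestronglyMeasurable
        (continuous_const.max (continuous_const.sub (continuous_boundaryDist.div_const _)))
    · exact integrableOn_const (measure_lt_top_of_subset Set.inter_subset_right
        measure_ball_lt_top.ne).ne
    · refine .of_forall fun x => ?_
      rw [Real.norm_of_nonneg (le_max_left _ _)]
      refine max_le zero_le_one (sub_le_self _ (div_nonneg (boundaryDist_nonneg x) (by positivity)))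
    · filter_upwards [ae_restrict_mem (hO.inter isOpen_ball).measurableSet] with x hx
      refine tendsto_const_nhds.congr' ?_
      obtain ⟨m₀, hm₀⟩ := exists_nat_ge (2 / boundaryDist O x)
      filter_upwards [eventually_ge_atTop m₀] with m hm
      have hpos := boundaryDist_pos hO h0 hx
      rw [div_le_iff₀ hpos] at hm₀
      have : (m₀ : ℝ) ≤ m := by exact_mod_cast hm
      refine (max_eq_left ?_).symm
      rw [sub_nonpos, le_div_iff₀ (by positivity), one_mul]
      rw [mul_inv_le_iff₀ (by positivity)]
      nlinarith
  rw [integral_zero] at hlim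
  obtain ⟨m, hm⟩ := (hlim.eventually (gt_mem_nhds hε)).exists
  exact ⟨_, by positivity, hm⟩

/-- Few integer points of `O` are near the boundary. -/
lemma exists_card_near_boundary_le (hO : IsOpen O) (h0 : (0 : E n) ∉ O)
    (hinv : IsDilationInvariant O) (hfr : volume (frontier (O ∩ ball 0 1)) = 0)
    {ε : ℝ} (hε : 0 < ε) :
    ∃ η : ℝ, 0 < η ∧ ∀ᶠ N : ℕ in atTop,
      (((latticeFinset O N).filter fun p => boundaryDist O ((N : ℝ)⁻¹ • p) < η).card : ℝ)
        ≤ ε * (N : ℝ) ^ n := by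
  obtain ⟨η, hη, hint⟩ := exists_setIntegral_boundaryLayer_lt hO h0 (half_pos hε)
  refine ⟨η, hη, ?_⟩
  have hlim := tendsto_sum_latticeFinset hinv hO.measurableSet hfr
    (F := fun x => max 0 (1 - boundaryDist O x / (2 * η)))
    (continuous_const.max (continuous_const.sub (continuous_boundaryDist.div_const _)))
  filter_upwards [hlim.eventually (gt_mem_nhds hint), eventually_gt_atTop 0] with N hN hN0
  have hN0' : (0 : ℝ) < (N : ℝ) ^ n := by positivity
  rw [div_lt_iff₀ hN0'] at hN
  have h1 : (((latticeFinset O N).filter fun p => boundaryDist O ((N : ℝ)⁻¹ • p) < η).card : ℝ) / 2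
      ≤ ∑ p ∈ latticeFinset O N, max 0 (1 - boundaryDist O ((N : ℝ)⁻¹ • p) / (2 * η)) := by
    calc _ = ∑ p ∈ (latticeFinset O N).filter fun p => boundaryDist O ((N : ℝ)⁻¹ • p) < η,
          (1 / 2 : ℝ) := by rw [Finset.sum_const, nsmul_eq_mul]; ring
      _ ≤ ∑ p ∈ (latticeFinset O N).filter fun p => boundaryDist O ((N : ℝ)⁻¹ • p) < η,
          max 0 (1 - boundaryDist O ((N : ℝ)⁻¹ • p) / (2 * η)) := by
          refine Finset.sum_le_sum fun p hp => le_max_of_le_right ?_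
          have := (Finset.mem_filter.mp hp).2
          rw [le_sub_comm, div_le_iff₀ (by positivity)]
          linarith
      _ ≤ _ := Finset.sum_le_sum_of_subset_of_nonneg (Finset.filter_subset _ _)
          fun _ _ _ => le_max_left _ _
  linarith

/-- Riemann sums need a function continuous on the whole space. The cutoff vanishes on the
complement and `G` is bounded, so the product extends continuously by 0. -/
lemma continuous_cutoff_mul_indicator (hO : IsOpen O) {G : E n → ℝ} (hG : ContinuousOn G O)
    (hG1 : ∀ x, |G x| ≤ 1) {η : ℝ} (hη : 0 < η) :
    Continuous fun x => min 1 (boundaryDist O x / η) * (O ∩ ball 0 1).indicator G x := by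
  have hcut : Continuous fun x => min 1 (boundaryDist O x / η) :=
    continuous_const.min (continuous_boundaryDist.div_const _)
  rw [continuous_iff_continuousAt]
  intro x
  by_cases hx : x ∈ O ∩ ball 0 1
  · refine hcut.continuousAt.mul ?_
    refine (hG.continuousAt (hO.mem_nhds hx.1)).congr ?_
    filter_upwards [(hO.inter isOpen_ball).mem_nhds hx] with y hy
    rw [Set.indicator_of_mem hy]
  · rw [ContinuousAt, Set.indicator_of_notMem hx, mul_zero]
    refine squeeze_zero_norm (a := fun y => boundaryDist O y / η) (fun y => ?_) ?_
    · rw [norm_mul]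
      have h1 : ‖min 1 (boundaryDist O y / η)‖ ≤ boundaryDist O y / η := by
        rw [Real.norm_of_nonneg (le_min zero_le_one (div_nonneg (boundaryDist_nonneg y) hη.le))]
        exact min_le_right _ _
      have h2 : ‖(O ∩ ball 0 1).indicator G y‖ ≤ 1 :=
        (norm_indicator_le_norm_self G y).trans (hG1 y)
      simpa using mul_le_mul h1 h2 (norm_nonneg _) (div_nonneg (boundaryDist_nonneg y) hη.le)
    · have := (continuous_boundaryDist (O := O)).continuousAt (x := x) |>.div_const η
      rwa [ContinuousAt, boundaryDist_eq_zero hx, zero_div] at this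

end Boundary

/-! ### Exponential sums over the cone -/

/-- Along integer points far from the boundary, `k * f` is locally nearly a sequence with constant
`d`-th difference. -/
lemma eventually_norm_sum_circleChar_le {C : Set (E n)} (hinv : IsDilationInvariant C)
    (h0 : (0 : E n) ∉ C) {f : E n → ℝ} (hf : ContDiffOn ℝ ∞ f C) (d : ℕ) (v : E n) (k : ℤ)
    (hlim : Tendsto (iterDirDeriv C v (d + 1) f) (comap norm atTop ⊓ 𝓟 C) (𝓝 0))
    (H : ℕ) {η δ : ℝ} (hη : 0 < η) (hδ : 0 < δ) :
    ∀ᶠ N : ℕ in atTop, ∀ p : E n, η ≤ boundaryDist (interior C) ((N : ℝ)⁻¹ • p) →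
      (∀ j < H, p + (j : ℝ) • v ∈ interior C ∧ ‖p + (j : ℝ) • v‖ < N) ∧
      ‖∑ j ∈ Finset.range H, circleChar ((k * f (p + (j : ℝ) • v) : ℝ) : UnitAddCircle)‖
        ≤ H * (weylSup d H ((k * iterDirDeriv C v d f p : ℝ) : UnitAddCircle)
          + 2 * Real.pi * (H ^ d * δ)) := by
  -- A d-th difference based at j < H involves arguments up to j + d, so the segment must have
  -- length H + d.
  set M : ℝ := (H + d : ℝ) with hM
  have hM0 : 0 ≤ M := by positivity
  -- With the (d + 1)-st derivative below δ', k g varies by at most |k| δ' M ≤ δ along the segment;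
  -- the added ones keep the denominator positive.
  set δ' : ℝ := δ / ((|(k : ℝ)| + 1) * (M + 1)) with hδ'
  have hδpos : 0 < δ' := by positivity
  have h1 : ∃ R₀ : ℝ, ∀ x ∈ C, R₀ ≤ ‖x‖ → |iterDirDeriv C v (d + 1) f x| ≤ δ' := by
    have := hlim.eventually (Metric.ball_mem_nhds (0 : ℝ) hδpos)
    rw [eventually_inf_principal, eventually_comap, eventually_atTop] at this
    obtain ⟨R₀, hR₀⟩ := this
    refine ⟨R₀, fun x hx hxR => ?_⟩
    have := hR₀ ‖x‖ hxR x rfl hx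
    rw [dist_zero_right] at this
    exact this.le
  obtain ⟨R₀, hR₀⟩ := h1
  have hbig : Tendsto (fun N : ℕ => η * (N : ℝ)) atTop atTop :=
    tendsto_natCast_atTop_atTop.const_mul_atTop hη
  filter_upwards [hbig.eventually_gt_atTop (M * ‖v‖ + max R₀ 0), eventually_gt_atTop 0]
    with N hN hN0 p hp
  have hN0' : (0 : ℝ) < N := by exact_mod_cast hN0
  have hseg : ∀ t ∈ Set.Icc (0 : ℝ) M, p + t • v ∈ interior C ∧ ‖p + t • v‖ < N ∧
      R₀ ≤ ‖p + t • v‖ := by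
    intro t ht
    have htv : ‖t • v‖ ≤ M * ‖v‖ := by
      rw [norm_smul, Real.norm_of_nonneg ht.1]
      exact mul_le_mul_of_nonneg_right ht.2 (norm_nonneg _)
    have := add_mem_of_le_boundaryDist hinv.interior (fun h => h0 (interior_subset h)) hN0' hp
      (w := t • v) (by linarith [le_max_right R₀ 0])
    exact ⟨this.1, this.2.1, by linarith [this.2.2, le_max_left R₀ 0]⟩
  have hsegj : ∀ j < H, ((j : ℕ) : ℝ) ∈ Set.Icc (0 : ℝ) M := fun j hj =>
    ⟨Nat.cast_nonneg j, by
      have : (j : ℝ) ≤ H := by exact_mod_cast hj.le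
      have : (0 : ℝ) ≤ d := Nat.cast_nonneg d
      linarith⟩
  refine ⟨fun j hj => ⟨(hseg j (hsegj j hj)).1, (hseg j (hsegj j hj)).2.1⟩, ?_⟩
  have hvar : ∀ t ∈ Set.Icc (0 : ℝ) M,
      |k * iterDirDeriv C v d f (p + t • v) - k * iterDirDeriv C v d f p| ≤ δ := by
    intro t ht
    have hmv := (convex_Icc (0 : ℝ) M).norm_image_sub_le_of_norm_hasDerivWithin_le
      (f := fun t : ℝ => iterDirDeriv C v d f (p + t • v))
      (f' := fun t : ℝ => iterDirDeriv C v (d + 1) f (p + t • v)) (C := δ')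
      (fun s hs => (hasDerivAt_iterDirDeriv hf v p d (hseg s hs).1).hasDerivWithinAt)
      (fun s hs => hR₀ _ (interior_subset (hseg s hs).1) (hseg s hs).2.2)
      (x := 0) (y := t) ⟨le_rfl, hM0⟩ ht
    simp only [zero_smul, add_zero, sub_zero, Real.norm_eq_abs] at hmv
    rw [← mul_sub, abs_mul]
    rw [abs_of_nonneg ht.1] at hmv
    calc _ ≤ (|(k : ℝ)| + 1) * (δ' * (M + 1)) := by
          refine mul_le_mul (by linarith) (hmv.trans ?_) (abs_nonneg _) (by positivity)
          exact mul_le_mul_of_nonneg_left (by linarith [ht.2]) hδpos.le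
      _ = δ := by rw [hδ']; field_simp
  refine norm_sum_circleChar_le_weylSup d H (fun j : ℕ => k * f (p + (j : ℝ) • v)) _ δ
    fun j hj => ?_
  have hIcc : ∀ t ∈ Set.Icc (j : ℝ) (j + d), t ∈ Set.Icc (0 : ℝ) M := by
    intro t ht
    have : (j : ℝ) ≤ H := by exact_mod_cast hj.le
    exact ⟨(Nat.cast_nonneg j).trans ht.1, by linarith [ht.2]⟩
  exact abs_fwdDiff_iter_sub_le d (fun i t => k * iterDirDeriv C v i f (p + t • v)) _ δ j
    (fun i _ t ht => (hasDerivAt_iterDirDeriv hf v p i (hseg t (hIcc t ht)).1).const_mul _)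
    (fun t ht => hvar t (hIcc t ht))

/-- Multiplication by k ≠ 0 preserves non-torsion points, so Weyl's theorem gives convergence almost
everywhere, and the constant 1 dominates. -/
lemma tendsto_integral_weylSup (d : ℕ) (hd : 1 ≤ d) {k : ℤ} (hk : k ≠ 0)
    (μ : Measure UnitAddCircle) [IsProbabilityMeasure μ]
    (hμ : ∀ᵐ y ∂μ, ¬ IsOfFinAddOrder y) :
    Tendsto (fun H : ℕ => ∫ y, weylSup d H (k • y) ∂μ) atTop (𝓝 0) := by
  have : Tendsto (fun H : ℕ => ∫ y, weylSup d H (k • y) ∂μ) atTop (𝓝 (∫ y, (0 : ℝ) ∂μ)) := by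
    refine tendsto_integral_of_dominated_convergence (fun _ => 1) (fun H => ?_)
      (integrable_const _) (fun H => ?_) ?_
    · exact ((continuous_weylSup d H).comp (continuous_zsmul k)).aestronglyMeasurable
    · exact .of_forall fun y => by
        rw [Real.norm_of_nonneg (weylSup_nonneg _ _ _)]; exact weylSup_le_one _ _ _
    · filter_upwards [hμ] with y hy
      refine tendsto_weylSup d hd fun h => hy ?_
      rw [isOfFinAddOrder_iff_zsmul_eq_zero] at h ⊢
      obtain ⟨m, hm, hm'⟩ := h
      exact ⟨m * k, mul_ne_zero hm hk, by rw [mul_smul, hm']⟩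
  simpa using this

lemma countable_isOfFinAddOrder : {y : UnitAddCircle | IsOfFinAddOrder y}.Countable := by
  have : {y : UnitAddCircle | IsOfFinAddOrder y}
      ⊆ ⋃ m : ℕ, {y : UnitAddCircle | (m + 1) • y = 0} := by
    intro y hy
    obtain ⟨m, hm, hm'⟩ := isOfFinAddOrder_iff_nsmul_eq_zero.mp hy
    refine Set.mem_iUnion.mpr ⟨m - 1, ?_⟩
    show (m - 1 + 1) • y = 0
    rwa [Nat.sub_add_cancel hm]
  exact (Set.countable_iUnion fun m =>
    (AddCircle.finite_torsion (1 : ℝ) m.succ_pos).countable).mono this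

lemma not_isOfFinAddOrder_coe {α : ℝ} (hα : Irrational α) :
    ¬ IsOfFinAddOrder (α : UnitAddCircle) := by
  intro h
  obtain ⟨m, hm, hm'⟩ := isOfFinAddOrder_iff_nsmul_eq_zero.mp h
  rw [← AddCircle.coe_nsmul, AddCircle.coe_eq_zero_iff] at hm'
  obtain ⟨l, hl⟩ := hm'
  refine hα ⟨(l : ℚ) / m, ?_⟩
  have hm0 : (m : ℝ) ≠ 0 := by exact_mod_cast hm.ne'
  push_cast
  rw [div_eq_iff hm0]
  simpa [mul_comm] using hl

/-- This is the only way in which the two alternatives for μ enter the theorem. -/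
lemma ae_not_isOfFinAddOrder {μ : Measure UnitAddCircle}
    (hμ : μ ≪ AddCircle.haarAddCircle (T := (1 : ℝ)) ∨
      ∃ α : ℝ, Irrational α ∧ μ = Measure.dirac (α : UnitAddCircle)) :
    ∀ᵐ y ∂μ, ¬ IsOfFinAddOrder y := by
  rcases hμ with h | ⟨α, hα, rfl⟩
  · refine h.ae_le (?_ : ∀ᵐ y ∂AddCircle.haarAddCircle (T := (1 : ℝ)), ¬ IsOfFinAddOrder y)
    rw [ae_iff]
    simp only [not_not]
    have h1 := AddCircle.volume_eq_smul_haarAddCircle (T := (1 : ℝ))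
    rw [ENNReal.ofReal_one, one_smul] at h1
    have : NullSingletonClass (volume : Measure UnitAddCircle) := ⟨fun x => by
      rw [← closedBall_zero, AddCircle.volume_closedBall]
      simp⟩
    rw [← h1]
    exact countable_isOfFinAddOrder.measure_zero _
  · rw [ae_dirac_eq]
    exact not_isOfFinAddOrder_coe hα

/-- Exponential sums over the interior of the cone are small, along integer radii. -/
theorem eventually_norm_sum_interior_cone_le {S : Set (sphere (0 : E n) 1)} (hS : IsSphericalCap S)
    {μ : Measure UnitAddCircle} [IsProbabilityMeasure μ] (hμ : ∀ᵐ y ∂μ, ¬ IsOfFinAddOrder y)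
    {f : E n → ℝ} (hf : ContDiffOn ℝ ∞ f (cone S)) {d : ℕ} (hd : 1 ≤ d) (v : Fin n → ℤ)
    (hhom : ∀ x ∈ cone S, ∀ s : ℝ, 0 < s →
        iterDirDeriv (cone S) (intVec v) d f (s • x) = iterDirDeriv (cone S) (intVec v) d f x)
    (hmap : (capMeasure S).map
        (modOne fun x : sphere (0 : E n) 1 => iterDirDeriv (cone S) (intVec v) d f x) = μ)
    (hlim : Tendsto (iterDirDeriv (cone S) (intVec v) (d + 1) f)
        (comap norm atTop ⊓ 𝓟 (cone S)) (𝓝 0))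
    {k : ℤ} (hk : k ≠ 0) {ε : ℝ} (hε : 0 < ε) :
    ∀ᶠ N : ℕ in atTop, ‖∑ p ∈ latticeFinset (interior (cone S)) N,
      circleChar ((k * f p : ℝ) : UnitAddCircle)‖ ≤ ε * (N : ℝ) ^ n := by
  set C := cone S with hC
  set O := interior C with hO
  set g := iterDirDeriv C (intVec v) d f with hg
  have hinv : IsDilationInvariant C := isDilationInvariant_cone
  have hC0 : (0 : E n) ∉ C := zero_notMem_cone
  have hO0 : (0 : E n) ∉ O := fun h => hC0 (interior_subset h)
  have hOo : IsOpen O := isOpen_interior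
  have hfr : volume (frontier (O ∩ ball 0 1)) = 0 := volume_frontier_inter_ball
    (measure_mono_null frontier_interior_subset hS.volume_frontier_cone)
  set V := volume.real (C ∩ ball 0 1) with hV
  have hV0 : 0 ≤ V := measureReal_nonneg
  have hcount : ∀ᶠ N : ℕ in atTop, ((latticeFinset O N).card : ℝ) ≤ (V + 1) * (N : ℝ) ^ n := by
    have h1 := (tendsto_card_latticeFinset hinv.interior hOo.measurableSet hfr).comp
      tendsto_natCast_atTop_atTop
    have h2 : volume.real (O ∩ ball 0 1) < V + 1 := by
      have : volume.real (O ∩ ball 0 1) ≤ V := measureReal_mono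
        (Set.inter_subset_inter_left _ interior_subset)
        (measure_lt_top_of_subset Set.inter_subset_right measure_ball_lt_top.ne).ne
      linarith
    filter_upwards [h1.eventually (gt_mem_nhds h2), eventually_gt_atTop 0] with N hN hN0
    have hN0' : (0 : ℝ) < (N : ℝ) ^ n := by positivity
    exact ((div_lt_iff₀ hN0').mp hN).le
  -- H is fixed before N tends to infinity; the factor V + 1 leaves room for the volume and, later,
  -- for the number of lattice points.
  obtain ⟨H, hH, hH0⟩ : ∃ H : ℕ, ∫ y, weylSup d H (k • y) ∂μ < ε / (8 * (V + 1)) ∧ 0 < H :=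
    (((tendsto_integral_weylSup d hd hk μ hμ).eventually
      (gt_mem_nhds (by positivity))).and (eventually_gt_atTop 0)).exists
  have hH' : (0 : ℝ) < H := by exact_mod_cast hH0
  set G : E n → ℝ := fun x => weylSup d H ((k * g x : ℝ) : UnitAddCircle) with hG
  have hGk : ∀ x, G x = weylSup d H (k • (g x : UnitAddCircle)) := fun x => by
    rw [hG, ← AddCircle.coe_zsmul, zsmul_eq_mul]
  have hG0 : ∀ x, 0 ≤ G x := fun x => weylSup_nonneg _ _ _
  have hG1 : ∀ x, |G x| ≤ 1 := fun x => by
    rw [abs_of_nonneg (hG0 x)]; exact weylSup_le_one _ _ _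
  have hGc : ContinuousOn G O := by
    refine (continuous_weylSup d H).comp_continuousOn ((AddCircle.continuous_mk' 1).comp_continuousOn ?_)
    exact continuousOn_const.mul (contDiffOn_iterDirDeriv hf (intVec v) d).continuousOn
  have hGint : ∫ x in O ∩ ball 0 1, G x < ε / 8 := by
    simp only [hGk]
    rw [setIntegral_cone_eq_mul_integral hS g hhom hmap
      (Φ := fun y => weylSup d H (k • y)) ((continuous_weylSup d H).comp (continuous_zsmul k))]
    rw [lt_div_iff₀ (by positivity)] at hH
    have h0 : 0 ≤ ∫ y, weylSup d H (k • y) ∂μ := integral_nonneg fun y => weylSup_nonneg _ _ _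
    rcases h0.eq_or_lt with h0 | h0
    · rw [← h0, mul_zero]; positivity
    · nlinarith
  obtain ⟨η, hη, hbad⟩ := exists_card_near_boundary_le hOo hO0 hinv.interior hfr
    (show (0 : ℝ) < ε / 16 by positivity)
  -- χ is continuous, at most `G` on the truncated cone, and equal to `G` at rescaled points outside
  -- the layer of width η.
  set χ : E n → ℝ := fun x => min 1 (boundaryDist O x / η) * (O ∩ ball 0 1).indicator G x with hχ
  have hχc : Continuous χ := continuous_cutoff_mul_indicator hOo hGc hG1 hη
  have hχ0 : ∀ x, 0 ≤ χ x := fun x => mul_nonneg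
    (le_min zero_le_one (div_nonneg (boundaryDist_nonneg x) hη.le))
    (Set.indicator_nonneg (fun x _ => hG0 x) x)
  have hχint : ∫ x in O ∩ ball 0 1, χ x < ε / 8 := by
    refine lt_of_le_of_lt (setIntegral_mono_on ?_ ?_ (hOo.inter isOpen_ball).measurableSet ?_) hGint
    · exact (hχc.continuousOn.integrableOn_compact (isCompact_closedBall (0 : E n) 1)).mono_set
        (Set.inter_subset_right.trans ball_subset_closedBall)
    · have : IsFiniteMeasure (volume.restrict (O ∩ ball 0 1)) := ⟨by
        rw [Measure.restrict_apply_univ]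
        exact measure_lt_top_of_subset Set.inter_subset_right measure_ball_lt_top.ne⟩
      exact Integrable.of_bound ((hGc.mono Set.inter_subset_left).aestronglyMeasurable
        (hOo.inter isOpen_ball).measurableSet) 1 (.of_forall hG1)
    · intro x hx
      simp only [hχ, Set.indicator_of_mem hx]
      exact mul_le_of_le_one_left (hG0 x) (min_le_left _ _)
  have hχlim := tendsto_sum_latticeFinset hinv.interior hOo.measurableSet hfr hχc
  -- Chosen so that the approximation error 2π H^d δ equals ε / (8(V + 1)).
  set δ : ℝ := ε / (8 * (V + 1)) / (2 * Real.pi * H ^ d) with hδ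
  have hδ0 : 0 < δ := by positivity
  filter_upwards [hcount, hbad, hχlim.eventually (gt_mem_nhds hχint), eventually_gt_atTop 0,
    eventually_norm_sum_circleChar_le hinv hC0 hf d (intVec v) k hlim H hη hδ0]
    with N hcN hbN hχN hN0 hgood
  have hN0' : (0 : ℝ) < N := by exact_mod_cast hN0
  rw [div_lt_iff₀ (by positivity)] at hχN
  set L := latticeFinset O N with hL
  set B := L.filter fun p => boundaryDist O ((N : ℝ)⁻¹ • p) < η with hB
  set u : E n → ℂ := fun p => circleChar ((k * f p : ℝ) : UnitAddCircle) with hu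
  have hu1 : ∀ p, ‖u p‖ ≤ 1 := fun p => (norm_circleChar _).le
  have hgood' : ∀ p ∈ L, p ∉ B → η ≤ boundaryDist O ((N : ℝ)⁻¹ • p) := by
    intro p hp hpB
    by_contra hlt
    exact hpB (Finset.mem_filter.mpr ⟨hp, not_le.mp hlt⟩)
  have hshift : ∀ j < H, ‖∑ p ∈ L, u p - ∑ p ∈ L, u (p + (j : ℝ) • intVec v)‖ ≤ 2 * B.card := by
    intro j hj
    refine norm_sum_sub_sum_shift_le L u hu1 _ B fun p hp hpB => ?_
    have h1 := (hgood p (hgood' p hp hpB)).1 j hj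
    refine mem_latticeFinset.mpr ⟨?_, h1⟩
    obtain ⟨w, rfl⟩ := (mem_latticeFinset.mp hp).1
    exact ⟨w + j • v, by rw [intVec_add, intVec_nsmul]⟩
  have hinner : ∀ p ∈ L, ‖∑ j ∈ Finset.range H, u (p + (j : ℝ) • intVec v)‖
      ≤ H * (χ ((N : ℝ)⁻¹ • p) + ε / (8 * (V + 1))) + H * (if p ∈ B then 1 else 0) := by
    intro p hp
    have hterm : 0 ≤ ε / (8 * (V + 1)) := by positivity
    split_ifs with hpB
    · have h1 : ‖∑ j ∈ Finset.range H, u (p + (j : ℝ) • intVec v)‖ ≤ H := by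
        have := norm_sum_circleChar_le (Finset.range H)
          fun j : ℕ => ((k * f (p + (j : ℝ) • intVec v) : ℝ) : UnitAddCircle)
        rwa [Finset.card_range] at this
      have := mul_nonneg hH'.le (add_nonneg (hχ0 ((N : ℝ)⁻¹ • p)) hterm)
      linarith
    · refine ((hgood p (hgood' p hp hpB)).2).trans ?_
      rw [mul_zero, add_zero]
      refine mul_le_mul_of_nonneg_left (add_le_add ?_ ?_) hH'.le
      · have hpm := mem_latticeFinset.mp hp
        have hpO : (N : ℝ)⁻¹ • p ∈ O ∩ ball 0 1 := by
          refine ⟨hinv.interior p hpm.2.1 _ (inv_pos.mpr hN0'), ?_⟩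
          rw [mem_ball_zero_iff, norm_smul, norm_inv, Real.norm_of_nonneg hN0'.le,
            inv_mul_lt_iff₀ hN0', mul_one]
          exact hpm.2.2
        have hmin : min 1 (boundaryDist O ((N : ℝ)⁻¹ • p) / η) = 1 :=
          min_eq_left ((one_le_div hη).mpr (hgood' p hp hpB))
        simp only [hχ, hmin, one_mul, Set.indicator_of_mem hpO, hG]
        rw [hhom p (interior_subset hpm.2.1) _ (inv_pos.mpr hN0')]
      · rw [hδ]
        refine le_of_eq ?_
        field_simp
  -- Budget per shift: boundary points count three times, twice for the shift and once for the
  -- trivial bound, giving 3ε/16; the Riemann sum and the approximation error give ε/8 each.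
  have hHsum : H * ‖∑ p ∈ L, u p‖ ≤ H * (ε * (N : ℝ) ^ n) := by
    have h1 : ‖H * ∑ p ∈ L, u p - ∑ j ∈ Finset.range H, ∑ p ∈ L, u (p + (j : ℝ) • intVec v)‖
        ≤ H * (2 * B.card) := by
      have : H * ∑ p ∈ L, u p - ∑ j ∈ Finset.range H, ∑ p ∈ L, u (p + (j : ℝ) • intVec v)
          = ∑ j ∈ Finset.range H, (∑ p ∈ L, u p - ∑ p ∈ L, u (p + (j : ℝ) • intVec v)) := by
        rw [Finset.sum_sub_distrib]; simp
      rw [this]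
      refine (norm_sum_le_of_le _ fun j hj => hshift j (Finset.mem_range.mp hj)).trans ?_
      simp
    have h2 : ‖∑ j ∈ Finset.range H, ∑ p ∈ L, u (p + (j : ℝ) • intVec v)‖
        ≤ H * (∑ p ∈ L, χ ((N : ℝ)⁻¹ • p) + L.card * (ε / (8 * (V + 1)))) + H * B.card := by
      rw [Finset.sum_comm]
      refine (norm_sum_le_of_le _ hinner).trans (le_of_eq ?_)
      rw [Finset.sum_add_distrib, ← Finset.mul_sum, ← Finset.mul_sum, Finset.sum_add_distrib,
        Finset.sum_const, nsmul_eq_mul, Finset.sum_ite_mem, Finset.sum_const, nsmul_eq_mul, mul_one,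
        Finset.inter_eq_right.mpr (Finset.filter_subset _ _)]
    have h3 : (L.card : ℝ) * (ε / (8 * (V + 1))) ≤ ε / 8 * (N : ℝ) ^ n := by
      calc _ ≤ (V + 1) * (N : ℝ) ^ n * (ε / (8 * (V + 1))) := by gcongr
        _ = _ := by field_simp
    have h4 : ‖(H : ℂ) * ∑ p ∈ L, u p‖ ≤ H * (2 * B.card) +
        (H * (∑ p ∈ L, χ ((N : ℝ)⁻¹ • p) + L.card * (ε / (8 * (V + 1)))) + H * B.card) := by
      refine (norm_le_insert' _ (∑ j ∈ Finset.range H, ∑ p ∈ L, u (p + (j : ℝ) • intVec v))).trans ?_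
      linarith
    rw [norm_mul, Complex.norm_natCast] at h4
    refine h4.trans ?_
    rw [← mul_add, ← mul_add]
    refine mul_le_mul_of_nonneg_left ?_ hH'.le
    have : 0 < ε * (N : ℝ) ^ n := by positivity
    nlinarith
  exact le_of_mul_le_mul_left hHsum hH'

lemma tendsto_card_latticeFinset_cone {S : Set (sphere (0 : E n) 1)} (hS : IsSphericalCap S) :
    Tendsto (fun R : ℝ => ((latticeFinset (cone S) R).card : ℝ) / R ^ n) atTop
      (𝓝 (volume.real (cone S ∩ ball 0 1))) :=
  tendsto_card_latticeFinset isDilationInvariant_cone hS.measurableSet_cone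
    (volume_frontier_inter_ball hS.volume_frontier_cone)

lemma eventually_latticeFinset_cone_nonempty {S : Set (sphere (0 : E n) 1)}
    (hS : IsSphericalCap S) : ∀ᶠ R : ℝ in atTop, (latticeFinset (cone S) R).Nonempty := by
  filter_upwards [(tendsto_card_latticeFinset_cone hS).eventually
    (lt_mem_nhds hS.volume_cone_inter_ball_pos)] with R hR
  by_contra h
  simp [Finset.not_nonempty_iff_eq_empty.mp h] at hR

/-- Exponential sums over the cone are small compared to the number of integer points. -/
theorem tendsto_sum_circleChar_div_card {S : Set (sphere (0 : E n) 1)} (hS : IsSphericalCap S)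
    (u : E n → ℂ) (hu : ∀ p, ‖u p‖ ≤ 1)
    (h : ∀ ε > 0, ∀ᶠ N : ℕ in atTop,
      ‖∑ p ∈ latticeFinset (interior (cone S)) N, u p‖ ≤ ε * (N : ℝ) ^ n) :
    Tendsto (fun R : ℝ => ((latticeFinset (cone S) R).card : ℂ)⁻¹ *
      ∑ p ∈ latticeFinset (cone S) R, u p) atTop (𝓝 0) := by
  set C := cone S with hC
  set O := interior C with hO
  have hinv : IsDilationInvariant C := isDilationInvariant_cone
  have hset : (O ∩ ball 0 1 : Set (E n)) =ᵐ[volume] (C ∩ ball 0 1 : Set (E n)) :=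
    (interior_ae_eq_of_null_frontier hS.volume_frontier_cone).inter (ae_eq_refl _)
  have hfrO : volume (frontier (O ∩ ball 0 1)) = 0 := volume_frontier_inter_ball
    (measure_mono_null frontier_interior_subset hS.volume_frontier_cone)
  set V := volume.real (C ∩ ball 0 1) with hV
  have hVpos : 0 < V := hS.volume_cone_inter_ball_pos
  have hcC : Tendsto (fun R : ℝ => ((latticeFinset C R).card : ℝ) / R ^ n) atTop (𝓝 V) :=
    tendsto_card_latticeFinset_cone hS
  have hcO : Tendsto (fun R : ℝ => ((latticeFinset O R).card : ℝ) / R ^ n) atTop (𝓝 V) := by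
    rw [hV, ← measureReal_congr hset]
    exact tendsto_card_latticeFinset hinv.interior isOpen_interior.measurableSet hfrO
  have hratio : Tendsto (fun R : ℝ => ((⌊R⌋₊ : ℝ) / R) ^ n) atTop (𝓝 1) := by
    simpa using (tendsto_nat_floor_div_atTop (R := ℝ)).pow n
  -- Small sums are known for integral radii only; replacing R by its floor does not change the
  -- leading term of the count.
  have hcOf : Tendsto (fun R : ℝ => ((latticeFinset O (⌊R⌋₊ : ℝ)).card : ℝ) / R ^ n) atTop (𝓝 V) := by
    have h1 := (hcO.comp (tendsto_natCast_atTop_atTop.comp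
      (tendsto_nat_floor_atTop (α := ℝ)))).mul hratio
    rw [mul_one] at h1
    refine h1.congr' ?_
    filter_upwards [eventually_ge_atTop 1] with R hR
    have : 0 < (⌊R⌋₊ : ℝ) := by exact_mod_cast Nat.floor_pos.mpr hR
    simp only [Function.comp_apply]
    rw [div_pow, div_mul_div_cancel₀ (by positivity)]
  have hsmall : Tendsto (fun R : ℝ => (∑ p ∈ latticeFinset C R, u p) / (R : ℂ) ^ n) atTop (𝓝 0) := by
    have hO1 : Tendsto (fun R : ℝ => ‖∑ p ∈ latticeFinset O (⌊R⌋₊ : ℝ), u p‖ / R ^ n) atTop (𝓝 0) := by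
      refine tendsto_order.mpr ⟨fun a ha => ?_, fun ε hε => ?_⟩
      · filter_upwards [eventually_gt_atTop 0] with R hR
        exact ha.trans_le (by positivity)
      · filter_upwards [(tendsto_nat_floor_atTop (α := ℝ)).eventually (h (ε / 2) (half_pos hε)),
          eventually_gt_atTop 0] with R hR hR0
        rw [div_lt_iff₀ (by positivity)]
        calc _ ≤ ε / 2 * (⌊R⌋₊ : ℝ) ^ n := hR
          _ ≤ ε / 2 * R ^ n := by gcongr; exact Nat.floor_le hR0.le
          _ < ε * R ^ n := by
            have : 0 < R ^ n := by positivity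
            nlinarith
    -- The points left over, on the boundary of the cone or in the shell between ⌊R⌋ and R, number
    -- o(R^n) because both counts are asymptotic to V R^n.
    have hbound := hO1.add (hcC.sub hcOf)
    rw [sub_self, add_zero] at hbound
    refine squeeze_zero_norm' ?_ hbound
    filter_upwards [eventually_gt_atTop 0] with R hR
    have hsub : latticeFinset O (⌊R⌋₊ : ℝ) ⊆ latticeFinset C R := by
      intro p hp
      obtain ⟨h1, h2, h3⟩ := mem_latticeFinset.mp hp
      exact mem_latticeFinset.mpr ⟨h1, interior_subset h2, h3.trans_le (Nat.floor_le hR.le)⟩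
    rw [norm_div, norm_pow, Complex.norm_real, Real.norm_of_nonneg hR.le, ← sub_div, ← add_div]
    gcongr
    classical
    rw [← Finset.sum_sdiff hsub, add_comm]
    refine (norm_add_le _ _).trans (add_le_add le_rfl ?_)
    refine (norm_sum_le_of_le _ fun p _ => hu p).trans (le_of_eq ?_)
    rw [Finset.sum_const, nsmul_eq_mul, mul_one, Finset.card_sdiff_of_subset hsub,
      Nat.cast_sub (Finset.card_le_card hsub)]
  have hinvlim : Tendsto (fun R : ℝ => ((((latticeFinset C R).card : ℝ) / R ^ n : ℝ) : ℂ)⁻¹) atTop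
      (𝓝 ((V : ℂ)⁻¹)) :=
    ((Complex.continuous_ofReal.tendsto V).comp hcC).inv₀ (by exact_mod_cast hVpos.ne')
  have := hinvlim.mul hsmall
  rw [mul_zero] at this
  refine this.congr' ?_
  filter_upwards [eventually_gt_atTop 0] with R hR
  have hR' : (R : ℂ) ^ n ≠ 0 := pow_ne_zero _ (by exact_mod_cast hR.ne')
  push_cast
  rw [inv_div]
  by_cases hc : ((latticeFinset C R).card : ℂ) = 0
  · simp [hc]
  · field_simp

/-! ### Weyl's criterion and the conclusion -/

lemma integral_map_latticeMeasure (C : Set (E n)) (R : ℝ) (f : E n → ℝ) (φ : C(UnitAddCircle, ℝ)) :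
    ∫ z, φ z ∂((latticeMeasure C R).map (modOne f))
      = ((latticeFinset C R).card : ℝ)⁻¹ * ∑ p ∈ latticeFinset C R, φ (f p : UnitAddCircle) := by
  have hfin : (latticePoints C R).Finite := latticePoints_finite C R
  have hm : MeasurableSet (latticePoints C R) := hfin.measurableSet
  have : Finite (latticePoints C R) := hfin
  -- No measurability of `f` is needed: every function on a finite set of lattice points is
  -- measurable.
  have hae : AEMeasurable (modOne f) (Measure.count.restrict (latticePoints C R)) := by
    rw [aemeasurable_restrict_iff_comap_subtype hm]
    exact (measurable_of_countable _).aemeasurable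
  have hcount : Measure.count (latticePoints C R) = ((latticeFinset C R).card : ENNReal) := by
    rw [← coe_latticeFinset, Measure.count_apply_finset]
  have hint : IntegrableOn (fun p => φ (modOne f p)) (latticePoints C R) Measure.count := by
    have : IsFiniteMeasure (Measure.count.restrict (latticePoints C R)) := ⟨by
      rw [Measure.restrict_apply_univ, hcount]; exact ENNReal.natCast_lt_top _⟩
    exact Integrable.of_bound (φ.continuous.measurable.comp_aemeasurable hae).aestronglyMeasurable
      ‖φ‖ (.of_forall fun p => φ.norm_coe_le_norm _)
  rw [latticeMeasure, ProbabilityTheory.cond, integral_map (hae.smul_measure _)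
    φ.continuous.aestronglyMeasurable, integral_smul_measure, hcount, ENNReal.toReal_inv,
    ENNReal.toReal_natCast, smul_eq_mul]
  congr 1
  rw [← coe_latticeFinset, setIntegral_finset _ (by rwa [coe_latticeFinset])]
  refine Finset.sum_congr rfl fun p _ => ?_
  simp [modOne, measureReal_def]

/-- Translation by half a period of the character changes its sign but preserves Haar measure. -/
lemma integral_fourier_eq_zero {k : ℤ} (hk : k ≠ 0) :
    ∫ z, fourier k z ∂(AddCircle.haarAddCircle (T := (1 : ℝ))) = 0 :=
  integral_eq_zero_of_add_right_eq_neg (fourier_add_half_inv_index hk one_pos)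

/-- **Weyl's criterion** for averages over finite sets. -/
theorem tendsto_average_of_fourier {ι : Type*} {l : Filter ι} {X : Type*} (L : ι → Finset X)
    (hL : ∀ᶠ i in l, (L i).Nonempty) (g : X → UnitAddCircle)
    (h : ∀ k : ℤ, k ≠ 0 → Tendsto (fun i => ((L i).card : ℂ)⁻¹ * ∑ p ∈ L i, fourier k (g p)) l (𝓝 0))
    (φ : C(UnitAddCircle, ℂ)) :
    Tendsto (fun i => ((L i).card : ℂ)⁻¹ * ∑ p ∈ L i, φ (g p)) l
      (𝓝 (∫ z, φ z ∂(AddCircle.haarAddCircle (T := (1 : ℝ))))) := by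
  have hi : ∀ ψ : C(UnitAddCircle, ℂ), Integrable ψ (AddCircle.haarAddCircle (T := (1 : ℝ))) :=
    fun ψ => ψ.continuous.integrable_of_hasCompactSupport (HasCompactSupport.of_compactSpace _)
  have hspan : ∀ ψ ∈ Submodule.span ℂ (Set.range (fourier (T := (1 : ℝ)))),
      Tendsto (fun i => ((L i).card : ℂ)⁻¹ * ∑ p ∈ L i, ψ (g p)) l
        (𝓝 (∫ z, ψ z ∂(AddCircle.haarAddCircle (T := (1 : ℝ))))) := by
    intro ψ hψ
    induction hψ using Submodule.span_induction with
    | mem ψ hψ =>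
      obtain ⟨k, rfl⟩ := hψ
      rcases eq_or_ne k 0 with rfl | hk
      · simp only [fourier_zero, Finset.sum_const, nsmul_eq_mul, mul_one, integral_const,
          probReal_univ, one_smul]
        refine tendsto_const_nhds.congr' ?_
        filter_upwards [hL] with i hi
        rw [inv_mul_cancel₀]
        exact_mod_cast hi.card_pos.ne'
      · rw [integral_fourier_eq_zero hk]
        exact h k hk
    | zero => simpa using tendsto_const_nhds
    | add ψ₁ ψ₂ _ _ h₁ h₂ =>
      simp only [ContinuousMap.add_apply, Finset.sum_add_distrib, mul_add]
      rw [integral_add (hi ψ₁) (hi ψ₂)]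
      exact h₁.add h₂
    | smul c ψ _ h₁ =>
      simp only [ContinuousMap.smul_apply, smul_eq_mul, ← Finset.mul_sum, mul_left_comm _ c]
      rw [integral_const_mul]
      exact h₁.const_mul c
  -- Trigonometric polynomials are uniformly dense, and averages and integrals are both 1-Lipschitz
  -- for the uniform norm.
  have hφ : φ ∈ closure (Submodule.span ℂ (Set.range (fourier (T := (1 : ℝ)))) :
      Set C(UnitAddCircle, ℂ)) := by
    rw [← Submodule.topologicalClosure_coe, span_fourier_closure_eq_top]
    trivial
  rw [Metric.tendsto_nhds]
  intro ε hε
  obtain ⟨ψ, hψ, hd⟩ := Metric.mem_closure_iff.mp hφ (ε / 3) (by positivity)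
  have hclose : ∀ z, ‖φ z - ψ z‖ ≤ ε / 3 := fun z => by
    rw [← dist_eq_norm]; exact (ContinuousMap.dist_apply_le_dist z).trans hd.le
  have h1 : ‖∫ z, φ z ∂(AddCircle.haarAddCircle (T := (1 : ℝ)))
      - ∫ z, ψ z ∂(AddCircle.haarAddCircle (T := (1 : ℝ)))‖ ≤ ε / 3 := by
    rw [← integral_sub (hi φ) (hi ψ)]
    simpa using norm_integral_le_of_norm_le_const (μ := AddCircle.haarAddCircle (T := (1 : ℝ)))
      (.of_forall hclose)
  filter_upwards [Metric.tendsto_nhds.mp (hspan ψ hψ) (ε / 3) (by positivity)] with i hi3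
  have h2 : ‖((L i).card : ℂ)⁻¹ * ∑ p ∈ L i, φ (g p) - ((L i).card : ℂ)⁻¹ * ∑ p ∈ L i, ψ (g p)‖
      ≤ ε / 3 := by
    rw [← mul_sub, ← Finset.sum_sub_distrib, norm_mul, norm_inv, Complex.norm_natCast]
    calc _ ≤ ((L i).card : ℝ)⁻¹ * ((L i).card * (ε / 3)) := by
          gcongr
          exact (norm_sum_le_of_le _ fun p _ => hclose (g p)).trans (by simp)
      _ ≤ 1 * (ε / 3) := by
          rw [← mul_assoc]
          gcongr
          exact inv_mul_le_one
      _ = ε / 3 := one_mul _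
  rw [dist_eq_norm] at hi3 ⊢
  calc _ = ‖(((L i).card : ℂ)⁻¹ * ∑ p ∈ L i, φ (g p) - ((L i).card : ℂ)⁻¹ * ∑ p ∈ L i, ψ (g p))
        + (((L i).card : ℂ)⁻¹ * ∑ p ∈ L i, ψ (g p)
          - ∫ z, ψ z ∂(AddCircle.haarAddCircle (T := (1 : ℝ))))
        - (∫ z, φ z ∂(AddCircle.haarAddCircle (T := (1 : ℝ)))
          - ∫ z, ψ z ∂(AddCircle.haarAddCircle (T := (1 : ℝ))))‖ := by congr 1; ring
    _ ≤ _ := (norm_sub_le _ _).trans (add_le_add_left (norm_add_le _ _) _)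
    _ < ε := by linarith

end LatticeEquidistribution

end

theorem theorem2p2 (n : ℕ) (S : Set (Metric.sphere (0 : LatticeEquidistribution.E n) 1))
    (hS : LatticeEquidistribution.IsSphericalCap S)
    (μ : MeasureTheory.Measure UnitAddCircle) [MeasureTheory.IsProbabilityMeasure μ]
    (hμ : μ ≪ AddCircle.haarAddCircle (T := (1 : ℝ)) ∨
      ∃ α : ℝ, Irrational α ∧ μ = MeasureTheory.Measure.dirac (α : UnitAddCircle)) :
    LatticeEquidistribution.IsIrrationalMeasure S μ := by
  open LatticeEquidistribution in
  rintro f hf ⟨d, v, hd, hhom, hmap, hlim⟩ φ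
  simp only [integral_map_latticeMeasure]
  have hsums : ∀ k : ℤ, k ≠ 0 → Tendsto (fun R : ℝ => ((latticeFinset (cone S) R).card : ℂ)⁻¹ *
      ∑ p ∈ latticeFinset (cone S) R, fourier k (f p : UnitAddCircle)) atTop (𝓝 0) := by
    intro k hk
    have := tendsto_sum_circleChar_div_card hS
      (fun p => circleChar ((k * f p : ℝ) : UnitAddCircle)) (fun p => (norm_circleChar _).le)
      fun ε hε => eventually_norm_sum_interior_cone_le hS (ae_not_isOfFinAddOrder hμ) hf hd v hhom
        hmap hlim hk hε
    convert this using 6 with R p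
    rw [fourier_apply, circleChar, ← zsmul_eq_mul, AddCircle.coe_zsmul]
  have h := tendsto_average_of_fourier (l := atTop) (fun R : ℝ => latticeFinset (cone S) R)
    (eventually_latticeFinset_cone_nonempty hS)
    (fun p => (f p : UnitAddCircle)) hsums
    ⟨fun z => (φ z : ℂ), Complex.continuous_ofReal.comp φ.continuous⟩
  simp only [ContinuousMap.coe_mk] at h
  rw [integral_complex_ofReal] at h
  -- The criterion is complex-valued; for a real test function the real part recovers the claim.
  have hre := (Complex.continuous_re.tendsto _).comp h
  rw [Complex.ofReal_re] at hre
  refine hre.congr fun R => ?_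
  simp only [Function.comp_apply]
  rw [← Complex.ofReal_sum, ← Complex.ofReal_natCast, ← Complex.ofReal_inv, ← Complex.ofReal_mul,
    Complex.ofReal_re]
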